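/- Proposition 13. Equip $\mathbb{R}^8=\mathbb{R}^3\times\mathbb{R}\times\mathbb{R}^3\times\mathbb{R}\ni(x,s,y,t)$ with the quadratic form $q(x,s,y,t)=x\cdot y+st$ of signature $(4,4)$, and let $Q\subset P(\mathbb{R}^8)$ be the quadric $q=0$. The set of $4$-dimensional totally isotropic subspaces of $(\mathbb{R}^8,q)$ (equivalently, of projective $3$-spaces contained in $Q$), a subspace of the Grassmannian of $4$-planes of $\mathbb{R}^8$, has two connected components: $Q_+$, the one containing the graphs of the maps $(x,s)\mapsto(y,t)=(a\times x+sb,\,-b\cdot x)$, and $Q_-$, the one containing the twisted graphs of the maps $(x,t)\mapsto(y,s)=(a\times x+tb,\,-b\cdot x)$, for $a,b\in\mathbb{R}^3$. Let $S$ be a compact real-analytic (Hausdorff) surface without boundary, let $f:S\to\mathbb{R}^3$ be a real-analytic immersion, and let $g:S\to\mathbb{R}^3$ be a real-analytic infinitesimal isometric deformation of $f$, i.e. $df(p)v\cdot dg(p)v=0$ for all $p\in S$ and $v\in T_pS$. Let $\varphi=(f:1:g:-f\cdot g):S\to Q$ be the associated totally isotropic immersion, with lift $\psi=(f,1,g,-f\cdot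 g)$. For $p\in S$ let $\varphi_\pm(p)$ be the unique element of $Q_\pm$ containing the $3$-dimensional totally isotropic subspace $V_p=\mathbb{R}\psi(p)+\operatorname{im}d\psi(p)$ (whose projectivization is the projective plane tangent to $\varphi$ at $p$). Then $\varphi_-:S\to Q_-$ is an analytic immersion (that is, analytic with differential of rank $2$) on a dense open subset of $S$. If moreover $S$ is connected and $\varphi_+:S\to Q_+$ is not constant, then $\varphi_+$ is likewise an analytic immersion (analytic with differential of rank $2$) on a dense open subset of $S$. -/

import Mathlib

open scoped Manifold ContDiff

noncomputable section

namespace Darboux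

/-- The plane, model space of surfaces. -/
abbrev E2 : Type := EuclideanSpace ℝ (Fin 2)

/-- Euclidean 3-space. -/
abbrev E3 : Type := EuclideanSpace ℝ (Fin 3)

/-- The cross product of Euclidean 3-space. -/
def cross (a x : E3) : E3 := WithLp.toLp 2 (crossProduct a.ofLp x.ofLp)

/-- The space `ℝ⁸ = ℝ³ × ℝ × ℝ³ × ℝ`, grouped as `(x, s), (y, t)`. -/
abbrev R44 : Type := WithLp 2 (WithLp 2 (E3 × ℝ) × WithLp 2 (E3 × ℝ))

/-- The vector `(x, s, y, t)` of `ℝ⁸`. -/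
def vec (x : E3) (s : ℝ) (y : E3) (t : ℝ) : R44 :=
  WithLp.toLp 2 (WithLp.toLp 2 (x, s), WithLp.toLp 2 (y, t))

/-- The quadratic form `q(x, s, y, t) = x · y + s t`, of signature `(4, 4)`. -/
def q (v : R44) : ℝ := inner ℝ v.fst.fst v.snd.fst + v.fst.snd * v.snd.snd

/-- The 4-dimensional totally isotropic subspaces of `(ℝ⁸, q)`, i.e. the 3-dimensional projective
subspaces contained in the projective quadric `q = 0`. -/
def MaxIsotropic : Type :=
  {W : Submodule ℝ R44 // Module.finrank ℝ W = 4 ∧ ∀ v ∈ W, q v = 0}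

/-- The standard embedding of the Grassmannian into the vector space of endomorphisms: a subspace
is sent to the orthogonal projection onto it. This is an analytic embedding, so topology and ranks
of differentials can be computed after it (whatever the auxiliary Euclidean structure). -/
def proj (W : MaxIsotropic) : R44 →L[ℝ] R44 := W.1.starProjection

/-- The topology of the Grassmannian. -/
instance : TopologicalSpace MaxIsotropic := TopologicalSpace.induced proj inferInstance

theorem R44.ext' {v w : R44} (h1 : v.fst.fst = w.fst.fst) (h2 : v.fst.snd = w.fst.snd)
    (h3 : v.snd.fst = w.snd.fst) (h4 : v.snd.snd = w.snd.snd) : v = w :=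
  WithLp.ofLp_injective 2 (Prod.ext
    (WithLp.ofLp_injective 2 (Prod.ext h1 h2)) (WithLp.ofLp_injective 2 (Prod.ext h3 h4)))

theorem cross_add (a x y : E3) : cross a (x + y) = cross a x + cross a y := by
  simp [cross]

theorem cross_smul (a x : E3) (c : ℝ) : cross a (c • x) = c • cross a x := by
  simp [cross]

/-- `(x, s) ↦ (x, s, a × x + s b, - b · x)`. -/
def graphPlusMap (a b : E3) : E3 × ℝ →ₗ[ℝ] R44 where
  toFun w := vec w.1 w.2 (cross a w.1 + w.2 • b) (-inner ℝ b w.1)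
  map_add' w w' := by
    apply R44.ext' <;> simp [vec, cross_add, inner_add_right, add_smul] <;> abel
  map_smul' c w := by
    apply R44.ext' <;> simp [vec, cross_smul, inner_smul_right, mul_smul]

/-- `(x, t) ↦ (x, - b · x, a × x + t b, t)`. -/
def graphMinusMap (a b : E3) : E3 × ℝ →ₗ[ℝ] R44 where
  toFun w := vec w.1 (-inner ℝ b w.1) (cross a w.1 + w.2 • b) w.2
  map_add' w w' := by
    apply R44.ext' <;> simp [vec, cross_add, inner_add_right, add_smul] <;> abel
  map_smul' c w := by
    apply R44.ext' <;> simp [vec, cross_smul, inner_smul_right, mul_smul]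

theorem inner_cross_self (a x : E3) : inner ℝ x (cross a x) = 0 := by
  simp [cross, PiLp.inner_apply, Fin.sum_univ_three, crossProduct]
  ring

/-- The graph `(a, b)₊` of `(x, s) ↦ (y, t) = (a × x + s b, - b · x)`. -/
def graphPlus (a b : E3) : MaxIsotropic :=
  ⟨LinearMap.range (graphPlusMap a b), by
    constructor
    · rw [LinearMap.finrank_range_of_inj]
      · simp
      · intro w w' h
        have h1 := congrArg (fun v : R44 => v.fst.fst) h
        have h2 := congrArg (fun v : R44 => v.fst.snd) h
        exact Prod.ext h1 h2
    · rintro _ ⟨w, rfl⟩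
      simp [graphPlusMap, q, vec, inner_add_right, inner_cross_self, inner_smul_right,
        real_inner_comm]⟩

/-- The twisted graph `(a, b)₋` of `(x, t) ↦ (y, s) = (a × x + t b, - b · x)`. -/
def graphMinus (a b : E3) : MaxIsotropic :=
  ⟨LinearMap.range (graphMinusMap a b), by
    constructor
    · rw [LinearMap.finrank_range_of_inj]
      · simp
      · intro w w' h
        have h1 := congrArg (fun v : R44 => v.fst.fst) h
        have h2 := congrArg (fun v : R44 => v.snd.snd) h
        exact Prod.ext h1 h2
    · rintro _ ⟨w, rfl⟩
      simp [graphMinusMap, q, vec, inner_add_right, inner_cross_self, inner_smul_right,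
        real_inner_comm]
      ring⟩

instance : Nonempty MaxIsotropic := ⟨graphPlus 0 0⟩

/-- `Q₊`: the connected component of the space of maximal totally isotropic subspaces that
contains the (connected) family of the graphs `(a, b)₊`. -/
def Qplus : Set MaxIsotropic := connectedComponent (graphPlus 0 0)

/-- `Q₋`: the connected component of the space of maximal totally isotropic subspaces that
contains the (connected) family of the twisted graphs `(a, b)₋`. -/
def Qminus : Set MaxIsotropic := connectedComponent (graphMinus 0 0)

variable {S : Type*} [TopologicalSpace S] [ChartedSpace E2 S]

/-- The differential at `p` of a vector-valued map on a surface. -/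
def diffAt {E : Type*} [NormedAddCommGroup E] [NormedSpace ℝ E] (F : S → E) (p : S) :
    TangentSpace 𝓘(ℝ, E2) p →L[ℝ] E :=
  mfderiv 𝓘(ℝ, E2) 𝓘(ℝ, E) F p

/-- `f` has an injective differential at every point. -/
def IsImmersed (f : S → E3) : Prop := ∀ p : S, Function.Injective (diffAt f p)

/-- `g` is an infinitesimal isometric deformation of `f`, i.e. `df · dg = 0`. -/
def IsInfIsometricDeformation (f g : S → E3) : Prop :=
  ∀ (p : S) (v : TangentSpace 𝓘(ℝ, E2) p), inner ℝ (E := E3) (diffAt f p v) (diffAt g p v) = 0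

/-- The lift `ψ = (f, 1, g, - f · g)` to `ℝ⁸` of the map `φ = (f : 1 : g : - f · g)` with values in
the projective quadric `q = 0`. -/
def psi (f g : S → E3) (p : S) : R44 := vec (f p) 1 (g p) (-inner ℝ (f p) (g p))

/-- The linear subspace `V_p = ℝ ψ(p) + im dψ(p)` whose projectivization is the projective plane
tangent to `φ` at `p`. -/
def tangentPlane (f g : S → E3) (p : S) : Submodule ℝ R44 :=
  Submodule.span ℝ {psi f g p} ⊔ LinearMap.range (diffAt (psi f g) p).toLinearMap

/-- `φ₊(p)`: the element of `Q₊` that contains the projective plane tangent to `φ` at `p`. -/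
def phiPlus (f g : S → E3) (p : S) : MaxIsotropic :=
  Classical.epsilon fun W => W ∈ Qplus ∧ tangentPlane f g p ≤ W.1

/-- `φ₋(p)`: the element of `Q₋` that contains the projective plane tangent to `φ` at `p`. -/
def phiMinus (f g : S → E3) (p : S) : MaxIsotropic :=
  Classical.epsilon fun W => W ∈ Qminus ∧ tangentPlane f g p ≤ W.1

/-- `Φ` is an (analytic) immersion on a dense open set: it is analytic and its differential has
rank 2 at each point of such a set. -/
def HasRankTwoOnDenseOpen (Φ : S → MaxIsotropic) : Prop :=
  ∃ U : Set S, IsOpen U ∧ Dense U ∧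
    ContMDiffOn 𝓘(ℝ, E2) 𝓘(ℝ, R44 →L[ℝ] R44) ω (fun p => proj (Φ p)) U ∧
    ∀ p ∈ U, Module.finrank ℝ
      (LinearMap.range (diffAt (fun x => proj (Φ x)) p).toLinearMap) = 2

end Darboux

end

/-! In a chart there is a rotation field `r` with `dg = r × df`. Put `t = g - r × f`, let `A` be the
skew map of `ℝ³ × ℝ` with parameters `(r, t)`, let `n` be the normal of `f`, and let `m = (n, -n ·
f)` be the tangent plane of `f` seen as a linear form. Then `V_p = {(u, A u) | u ⊥ m}`
(`mem_tangent`). Exactly two maximal isotropic subspaces contain it: the graph of `A` and `{(u, A u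
+ c m) | u ⊥ m}` (`eq_graphPlus_or_eq_twisted`). Subspaces of the first kind lie in `Q₊` and those
of the second in `Q₋`, and the sign of a determinant separates the two components. Hence `φ₊` and
`φ₋` are given everywhere by explicit analytic formulas.

If the projection `P` onto a family of subspaces is stationary in a direction `v`, then `ds(v)` lies
in the subspace for every section `s`, because `s = P s`. For `φ₋` and the section built from
`df(v)` this says that the second fundamental form vanishes on `(v, v)`, so `φ₋` is immersive at
elliptic points. For `φ₊` it gives `dr(v) = 0`. The integrability conditions of `dg = r × df` are
`dr(v) × df(w) = dr(w) × df(v)`, `dr · n = 0` and the symmetry of `dr(v) · dn(w)`. At an elliptic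
point they turn `dr(v) = 0` for one `v ≠ 0` into `dr = 0`, and then `dt = -dr × f = 0`.

Globally, the locus of rank less than 2 is cut out in each chart by an analytic Gram determinant, so
its interior is open and closed. By compactness any nonempty open and closed set has a point
farthest from the origin, and that point is elliptic. For `φ₋` the interior is therefore empty. For
`φ₊` on a connected surface a nonempty interior is everything; then `φ₊` is constant near an
elliptic point, hence everywhere by analytic continuation. -/

noncomputable section

namespace Darboux

/-! ### Analytic dependence of orthogonal projections -/

section Projection

variable {E F X : Type*} [NormedAddCommGroup E] [InnerProductSpace ℝ E] [FiniteDimensional ℝ E]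
  [NormedAddCommGroup F] [InnerProductSpace ℝ F] [FiniteDimensional ℝ F]
  [NormedAddCommGroup X] [NormedSpace ℝ X]

theorem isInvertible_adjoint_comp_self {L : E →L[ℝ] F} (hL : Function.Injective L) :
    (L.adjoint ∘L L).IsInvertible := by
  have h : Function.Injective (L.adjoint ∘L L) :=
    (ContinuousLinearMap.adjoint_comp_self_injective_iff L).2 hL
  refine ⟨(LinearEquiv.ofInjectiveEndo (L.adjoint ∘L L).toLinearMap h).toContinuousLinearEquiv, ?_⟩
  ext x
  rfl

/-- These are the normal equations. The formula exhibits the projection as an analytic function of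
`L`, which is how every smoothness statement about subspaces is obtained. -/
theorem starProjection_range_eq {L : E →L[ℝ] F} (hL : Function.Injective L) :
    (LinearMap.range L.toLinearMap).starProjection
      = L ∘L (L.adjoint ∘L L).inverse ∘L L.adjoint := by
  ext v
  apply Submodule.eq_starProjection_of_mem_of_inner_eq_zero
  · exact ⟨_, rfl⟩
  · rintro _ ⟨w, rfl⟩
    obtain ⟨e, he⟩ := isInvertible_adjoint_comp_self hL
    have h1 : L.adjoint (L (e.symm (L.adjoint v))) = L.adjoint v := by
      have := DFunLike.congr_fun he (e.symm (L.adjoint v))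
      simpa using this.symm
    rw [← he]
    simp only [ContinuousLinearMap.coe_comp, Function.comp_apply,
      ContinuousLinearMap.inverse_equiv, ContinuousLinearEquiv.coe_coe,
      ContinuousLinearMap.coe_coe]
    rw [← ContinuousLinearMap.adjoint_inner_left, map_sub, h1, sub_self, inner_zero_left]

theorem contDiff_adjoint {n : WithTop ℕ∞} :
    ContDiff ℝ n (fun L : E →L[ℝ] F => L.adjoint) := by
  let T : (E →L[ℝ] F) →ₗ[ℝ] (F →L[ℝ] E) :=
    { toFun := fun L => L.adjoint
      map_add' := fun _ _ => by simp
      map_smul' := fun _ _ => by simp }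
  exact (LinearMap.toContinuousLinearMap T).contDiff

theorem contDiffOn_starProjection_range {n : WithTop ℕ∞} {L : X → E →L[ℝ] F} {U : Set X}
    (hL : ContDiffOn ℝ n L U) (hinj : ∀ x ∈ U, Function.Injective (L x)) :
    ContDiffOn ℝ n (fun x => (LinearMap.range (L x).toLinearMap).starProjection) U := by
  have hadj : ContDiffOn ℝ n (fun x => (L x).adjoint) U := contDiff_adjoint.comp_contDiffOn hL
  have hcomp : ContDiffOn ℝ n (fun x => (L x).adjoint ∘L L x) U := hadj.clm_comp hL
  have hinv : ContDiffOn ℝ n (fun x => ((L x).adjoint ∘L L x).inverse) U := fun x hx =>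
    ContDiffAt.comp_contDiffWithinAt (f := fun x => (L x).adjoint ∘L L x) x
      (isInvertible_adjoint_comp_self (hinj x hx)).contDiffAt_map_inverse (hcomp x hx)
  exact (hL.clm_comp (hinv.clm_comp hadj)).congr fun x hx => starProjection_range_eq (hinj x hx)

end Projection

/-! ### Parametrizations of the two families of isotropic subspaces -/

/-- The space `ℝ³ × ℝ` with its Euclidean structure. -/
abbrev H4 : Type := WithLp 2 (E3 × ℝ)

instance : ContinuousSMul ℝ H4 := IsBoundedSMul.continuousSMul (α := ℝ) (β := H4)
instance : ContinuousSMul ℝ R44 := IsBoundedSMul.continuousSMul (α := ℝ) (β := R44)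
instance : ContinuousConstSMul ℝ H4 := inferInstance
instance : ContinuousConstSMul ℝ R44 := inferInstance
instance : IsTopologicalAddGroup H4 := inferInstance
instance : IsTopologicalAddGroup R44 := inferInstance
instance : T2Space H4 := inferInstance
instance : T2Space R44 := inferInstance
instance : FiniteDimensional ℝ H4 := inferInstance
instance : FiniteDimensional ℝ R44 := inferInstance

/-- The point `(x, s)` of `ℝ³ × ℝ`. -/
def pt (x : E3) (s : ℝ) : H4 := WithLp.toLp 2 (x, s)

@[simp] theorem pt_fst (x : E3) (s : ℝ) : (pt x s).fst = x := rfl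
@[simp] theorem pt_snd (x : E3) (s : ℝ) : (pt x s).snd = s := rfl

theorem H4.ext' {u v : H4} (h1 : u.fst = v.fst) (h2 : u.snd = v.snd) : u = v :=
  WithLp.ofLp_injective 2 (Prod.ext h1 h2)

/-- The vector `(u, w)` of `ℝ⁸`. -/
def pair (u w : H4) : R44 := WithLp.toLp 2 (u, w)

@[simp] theorem pair_fst (u w : H4) : (pair u w).fst = u := rfl
@[simp] theorem pair_snd (u w : H4) : (pair u w).snd = w := rfl

theorem pair_ext {z z' : R44} (h1 : z.fst = z'.fst) (h2 : z.snd = z'.snd) : z = z' :=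
  WithLp.ofLp_injective 2 (Prod.ext h1 h2)

theorem inner_H4 (u w : H4) : inner ℝ u w = inner ℝ u.fst w.fst + u.snd * w.snd := by
  rw [WithLp.prod_inner_apply]
  simp [mul_comm]

theorem q_eq_inner (z : R44) : q z = inner ℝ z.fst z.snd := (inner_H4 _ _).symm

theorem inner_R44 (z w : R44) : inner ℝ z w = inner ℝ z.fst w.fst + inner ℝ z.snd w.snd :=
  WithLp.prod_inner_apply _ _

theorem add_cross (a a' x : E3) : cross (a + a') x = cross a x + cross a' x := by
  simp [cross]

theorem smul_cross (c : ℝ) (a x : E3) : cross (c • a) x = c • cross a x := by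
  simp [cross]

/-- The skew-symmetric endomorphism `(x, s) ↦ (a × x + s b, - b · x)` of `ℝ³ × ℝ`, as a linear
function of `(a, b)`. -/
def skewLin : E3 × E3 →ₗ[ℝ] H4 →ₗ[ℝ] H4 :=
  LinearMap.mk₂ ℝ (fun ab u => pt (cross ab.1 u.fst + u.snd • ab.2) (-inner ℝ ab.2 u.fst))
    (fun a b u => by apply H4.ext' <;> simp [add_cross, inner_add_left] <;> abel)
    (fun c a u => by
      apply H4.ext' <;> simp [smul_cross, inner_smul_left, smul_comm c])
    (fun a u v => by
      apply H4.ext' <;> simp [cross_add, inner_add_right, add_smul] <;> abel)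
    (fun c a u => by
      apply H4.ext' <;> simp [cross_smul, inner_smul_right, mul_smul])

/-- The skew-symmetric endomorphism `(x, s) ↦ (a × x + s b, - b · x)` of `ℝ³ × ℝ`. -/
def skew (ab : E3 × E3) : H4 →L[ℝ] H4 := LinearMap.toContinuousLinearMap (skewLin ab)

theorem skew_apply (ab : E3 × E3) (u : H4) :
    skew ab u = pt (cross ab.1 u.fst + u.snd • ab.2) (-inner ℝ ab.2 u.fst) := rfl

theorem skew_zero : skew 0 = 0 := by
  simp [skew]

theorem contDiff_skew {n : WithTop ℕ∞} : ContDiff ℝ n skew := by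
  let T : E3 × E3 →ₗ[ℝ] H4 →L[ℝ] H4 := LinearMap.toContinuousLinearMap.toLinearMap ∘ₗ skewLin
  exact (LinearMap.toContinuousLinearMap T).contDiff

theorem inner_skew_self (ab : E3 × E3) (u : H4) : inner ℝ u (skew ab u) = 0 := by
  rw [inner_H4, skew_apply]
  simp [inner_add_right, inner_cross_self, inner_smul_right, real_inner_comm]

theorem inner_skew (ab : E3 × E3) (u v : H4) :
    inner ℝ u (skew ab v) = -inner ℝ v (skew ab u) := by
  have h := inner_skew_self ab (u + v)
  rw [map_add, inner_add_left, inner_add_right, inner_add_right, inner_skew_self,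
    inner_skew_self] at h
  linarith

/-- The embedding `u ↦ (u, 0)`. -/
def inl4 : H4 →L[ℝ] R44 := LinearMap.toContinuousLinearMap
  { toFun := fun u => pair u 0
    map_add' := fun _ _ => by apply pair_ext <;> simp
    map_smul' := fun _ _ => by apply pair_ext <;> simp }

/-- The embedding `w ↦ (0, w)`. -/
def inr4 : H4 →L[ℝ] R44 := LinearMap.toContinuousLinearMap
  { toFun := fun u => pair 0 u
    map_add' := fun _ _ => by apply pair_ext <;> simp
    map_smul' := fun _ _ => by apply pair_ext <;> simp }

/-- The projection `(u, w) ↦ u`. -/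
def fst4 : R44 →L[ℝ] H4 := LinearMap.toContinuousLinearMap
  { toFun := fun z => z.fst
    map_add' := fun _ _ => rfl
    map_smul' := fun _ _ => rfl }

@[simp] theorem inl4_apply (u : H4) : inl4 u = pair u 0 := rfl
@[simp] theorem inr4_apply (u : H4) : inr4 u = pair 0 u := rfl

/-- The parametrization `u ↦ (u, A u)` of a graph. -/
def plusParam (ab : E3 × E3) : H4 →L[ℝ] R44 := inl4 + inr4 ∘L skew ab

theorem plusParam_apply (ab : E3 × E3) (u : H4) : plusParam ab u = pair u (skew ab u) := by
  apply pair_ext <;> simp [plusParam]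

theorem plusParam_injective (ab : E3 × E3) : Function.Injective (plusParam ab) := by
  intro u v h
  rw [plusParam_apply, plusParam_apply] at h
  exact congrArg (fun z : R44 => z.fst) h

theorem contDiff_plusParam {n : WithTop ℕ∞} : ContDiff ℝ n plusParam :=
  contDiff_const.add (contDiff_const.clm_comp contDiff_skew)

theorem mem_graphPlus {a b : E3} {z : R44} :
    z ∈ (graphPlus a b).1 ↔ z.snd = skew (a, b) z.fst := by
  constructor
  · rintro ⟨w, rfl⟩
    rfl
  · intro h
    refine ⟨(z.fst.fst, z.fst.snd), ?_⟩
    apply pair_ext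
    · rfl
    · rw [h]; rfl

theorem range_plusParam (ab : E3 × E3) :
    LinearMap.range (plusParam ab).toLinearMap = (graphPlus ab.1 ab.2).1 := by
  ext z
  rw [mem_graphPlus]
  constructor
  · rintro ⟨u, rfl⟩
    simp [plusParam_apply]
  · intro h
    refine ⟨z.fst, ?_⟩
    apply pair_ext <;> simp [plusParam_apply, h]

theorem contDiff_proj_graphPlus {n : WithTop ℕ∞} :
    ContDiff ℝ n (fun ab : E3 × E3 => proj (graphPlus ab.1 ab.2)) := by
  have h := contDiffOn_starProjection_range (n := n) contDiff_plusParam.contDiffOn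
    (U := Set.univ) (fun ab _ => plusParam_injective ab)
  rw [contDiffOn_univ] at h
  simpa only [range_plusParam, proj] using h

/-- The endomorphism `u ↦ |m|² u - (m · u) m`, with range the orthogonal complement of `m`. -/
def rej (m : H4) : H4 →L[ℝ] H4 :=
  (inner ℝ m m : ℝ) • ContinuousLinearMap.id ℝ H4 - (innerSL ℝ m).smulRight m

theorem rej_apply (m u : H4) : rej m u = (inner ℝ m m : ℝ) • u - (inner ℝ m u : ℝ) • m := by
  simp [rej]

theorem inner_rej (m u : H4) : inner ℝ m (rej m u) = 0 := by
  rw [rej_apply, inner_sub_right, inner_smul_right, inner_smul_right]; ring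

/-- A parametrization of the subspace `{(u, A u + c m) | u ⊥ m, c ∈ ℝ}`. -/
def minusParam (p : H4 × E3 × E3) : H4 →L[ℝ] R44 :=
  plusParam p.2 ∘L rej p.1 + inr4 ∘L (innerSL ℝ p.1).smulRight p.1

theorem minusParam_apply (p : H4 × E3 × E3) (u : H4) : minusParam p u =
    pair (rej p.1 u) (skew p.2 (rej p.1 u) + (inner ℝ p.1 u : ℝ) • p.1) := by
  apply pair_ext <;> simp [minusParam, plusParam_apply]

theorem contDiff_minusParam {n : WithTop ℕ∞} : ContDiff ℝ n minusParam := by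
  have h1 : ContDiff ℝ n (fun p : H4 × E3 × E3 => (innerSL ℝ p.1).smulRight p.1) :=
    ((innerSL ℝ).contDiff.comp contDiff_fst).smulRight contDiff_fst
  have h2 : ContDiff ℝ n (fun p : H4 × E3 × E3 => rej p.1) :=
    ((contDiff_fst.inner ℝ contDiff_fst).smul contDiff_const).sub h1
  exact ((contDiff_plusParam.comp contDiff_snd).clm_comp h2).add (contDiff_const.clm_comp h1)

theorem minusParam_injective {p : H4 × E3 × E3} (hp : p.1 ≠ 0) :
    Function.Injective (minusParam p) := by
  refine (injective_iff_map_eq_zero _).2 fun u hu => ?_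
  rw [minusParam_apply] at hu
  have h1 : rej p.1 u = 0 := congrArg (fun z : R44 => z.fst) hu
  have h2 : skew p.2 (rej p.1 u) + (inner ℝ p.1 u : ℝ) • p.1 = 0 :=
    congrArg (fun z : R44 => z.snd) hu
  rw [h1, map_zero, zero_add] at h2
  rw [rej_apply, h2, sub_zero] at h1
  exact (smul_eq_zero.1 h1).resolve_left (inner_self_ne_zero.2 hp)

theorem finrank_H4 : Module.finrank ℝ H4 = 4 := by
  rw [(WithLp.linearEquiv 2 ℝ (E3 × ℝ)).finrank_eq]
  simp

theorem finrank_R44 : Module.finrank ℝ R44 = 8 := by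
  rw [(WithLp.linearEquiv 2 ℝ (H4 × H4)).finrank_eq, Module.finrank_prod, finrank_H4]

/-- The maximal totally isotropic subspace `{(u, A u + c m) | u ⊥ m, c ∈ ℝ}`. -/
def twisted (p : H4 × E3 × E3) (hp : p.1 ≠ 0) : MaxIsotropic :=
  ⟨LinearMap.range (minusParam p).toLinearMap, by
    constructor
    · rw [LinearMap.finrank_range_of_inj (minusParam_injective hp), finrank_H4]
    · rintro _ ⟨u, rfl⟩
      have h : inner ℝ (rej p.1 u) p.1 = 0 := by rw [real_inner_comm, inner_rej]
      rw [q_eq_inner, ContinuousLinearMap.coe_coe, minusParam_apply, pair_fst, pair_snd,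
        inner_add_right, inner_skew_self, inner_smul_right, h, mul_zero, add_zero]⟩

theorem mem_twisted {p : H4 × E3 × E3} {hp : p.1 ≠ 0} {z : R44} :
    z ∈ (twisted p hp).1 ↔
      inner ℝ p.1 z.fst = 0 ∧ ∃ c : ℝ, z.snd = skew p.2 z.fst + c • p.1 := by
  constructor
  · rintro ⟨u, rfl⟩
    simp only [ContinuousLinearMap.coe_coe, minusParam_apply, pair_fst, pair_snd]
    exact ⟨inner_rej _ _, _, rfl⟩
  · rintro ⟨h, c, hc⟩
    have hm : (inner ℝ p.1 p.1 : ℝ) ≠ 0 := inner_self_ne_zero.2 hp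
    -- On `m^⊥` the map `rej m` is multiplication by `|m|²`, and it kills `m`; so the first summand
    -- produces `z.fst` and the second only the coefficient `c`.
    refine ⟨(inner ℝ p.1 p.1 : ℝ)⁻¹ • (z.fst + c • p.1), ?_⟩
    have h1 : rej p.1 ((inner ℝ p.1 p.1 : ℝ)⁻¹ • (z.fst + c • p.1)) = z.fst := by
      rw [map_smul, rej_apply, inner_add_right, h, inner_smul_right, smul_add, smul_smul,
        mul_comm _ c, zero_add, add_sub_cancel_right, smul_smul, inv_mul_cancel₀ hm, one_smul]
    have h2 : (inner ℝ p.1 ((inner ℝ p.1 p.1 : ℝ)⁻¹ • (z.fst + c • p.1)) : ℝ) = c := by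
      rw [inner_smul_right, inner_add_right, h, inner_smul_right]
      field_simp
      ring
    rw [ContinuousLinearMap.coe_coe, minusParam_apply, h1, h2]
    apply pair_ext <;> simp [hc]

theorem contDiffOn_proj_twisted {n : WithTop ℕ∞} :
    ContDiffOn ℝ n (fun p : H4 × E3 × E3 =>
      (LinearMap.range (minusParam p).toLinearMap).starProjection) {p | p.1 ≠ 0} :=
  contDiffOn_starProjection_range contDiff_minusParam.contDiffOn fun _ hp =>
    minusParam_injective hp

theorem twisted_eq_graphMinus (hp : (pt 0 1, (0 : E3 × E3)).1 ≠ 0) :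
    twisted (pt 0 1, 0) hp = graphMinus 0 0 := by
  apply Subtype.ext
  ext z
  rw [mem_twisted, skew_zero, inner_H4]
  constructor
  · rintro ⟨h, c, hc⟩
    refine ⟨(z.fst.fst, c), ?_⟩
    have h' : z.fst.snd = 0 := by simpa using h
    have h1 : z.snd.fst = 0 := by rw [hc]; simp
    have h2 : z.snd.snd = c := by rw [hc]; simp
    apply R44.ext' <;> simp [graphMinusMap, vec, cross, h', h1, h2]
  · rintro ⟨w, rfl⟩
    refine ⟨by simp [graphMinusMap, vec], w.2, ?_⟩
    apply H4.ext' <;> simp [graphMinusMap, vec, cross]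

/-! ### The components `Q₊` and `Q₋`, and their separation by a determinant -/

theorem graphPlus_mem_Qplus (a b : E3) : graphPlus a b ∈ Qplus := by
  have hc : Continuous (fun ab : E3 × E3 => graphPlus ab.1 ab.2) :=
    continuous_induced_rng.2 (contDiff_proj_graphPlus (n := 0)).continuous
  have h := (isPreconnected_univ (α := E3 × E3)).image _ hc.continuousOn
  exact h.subset_connectedComponent ⟨(0, 0), trivial, rfl⟩ ⟨(a, b), trivial, rfl⟩

/-- The parameter space is connected, since removing the origin does not disconnect a space of
dimension 4, and `m = (0, 1)`, `A = 0` gives the base point of `Q₋`. -/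
theorem twisted_mem_Qminus (p : H4 × E3 × E3) (hp : p.1 ≠ 0) : twisted p hp ∈ Qminus := by
  let T : {p : H4 × E3 × E3 | p.1 ≠ 0} → MaxIsotropic := fun p => twisted p.1 p.2
  have hT : Continuous T := continuous_induced_rng.2
    (contDiffOn_proj_twisted (n := 0)).continuousOn.domRestrict
  have h1 : IsPreconnected {p : H4 × E3 × E3 | p.1 ≠ 0} := by
    have h2 : IsPreconnected ({0}ᶜ : Set H4) := by
      refine (isConnected_compl_singleton_of_one_lt_rank ?_ _).isPreconnected
      rw [← Module.finrank_eq_rank, finrank_H4]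
      norm_num
    convert h2.prod (isPreconnected_univ (α := E3 × E3)) using 1
    ext p
    simp
  have : PreconnectedSpace {p : H4 × E3 × E3 | p.1 ≠ 0} := isPreconnected_iff_preconnectedSpace.1 h1
  have h3 := (isPreconnected_univ (α := {p : H4 × E3 × E3 | p.1 ≠ 0})).image T hT.continuousOn
  have h0 : (pt 0 1, (0 : E3 × E3)).1 ≠ 0 := fun h => by
    have := congrArg (fun u : H4 => u.snd) h
    simp at this
  refine h3.subset_connectedComponent ⟨⟨(pt 0 1, 0), h0⟩, trivial, twisted_eq_graphMinus h0⟩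
    ⟨⟨p, hp⟩, trivial, rfl⟩

/-- The exchange `(u, w) ↦ (w, u)`. -/
def swap4 (z : R44) : R44 := pair z.snd z.fst

theorem q_add (z w : R44) : q (z + w) = q z + q w + inner ℝ z (swap4 w) := by
  have h1 : (z + w).fst = z.fst + w.fst := rfl
  have h2 : (z + w).snd = z.snd + w.snd := rfl
  rw [q_eq_inner, q_eq_inner, q_eq_inner, inner_R44, swap4, pair_fst, pair_snd, h1, h2,
    inner_add_left, inner_add_right, inner_add_right, real_inner_comm z.snd w.fst]
  ring

theorem inner_swap4_of_mem (W : MaxIsotropic) {z w : R44} (hz : z ∈ W.1) (hw : w ∈ W.1) :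
    inner ℝ z (swap4 w) = 0 := by
  have h := q_add z w
  rw [W.2.2 _ hz, W.2.2 _ hw, W.2.2 _ (W.1.add_mem hz hw)] at h
  linarith

/-- The exchange as a linear automorphism. -/
def swapEquiv : R44 ≃ₗ[ℝ] R44 where
  toFun := swap4
  invFun := swap4
  map_add' _ _ := rfl
  map_smul' _ _ := rfl
  left_inv _ := rfl
  right_inv _ := rfl

/-- The polar form of `q` is `⟨z, swap w⟩`, so isotropy puts the swap of `W` inside `Wᗮ`; both have
dimension 4. -/
theorem orthogonal_eq_map_swap (W : MaxIsotropic) :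
    W.1ᗮ = W.1.map swapEquiv.toLinearMap := by
  symm
  apply Submodule.eq_of_le_of_finrank_eq
  · rintro _ ⟨w, hw, rfl⟩
    rw [Submodule.mem_orthogonal]
    exact fun z hz => inner_swap4_of_mem W hz hw
  · have h := W.1.finrank_add_finrank_orthogonal
    rw [W.2.1, finrank_R44] at h
    rw [LinearEquiv.finrank_map_eq, W.2.1]
    omega

/-- For an endomorphism `P`, the map `u ↦ ((2 P - 1) (u, u)).fst`. When `P` is the orthogonal
projection to a maximal isotropic subspace, `2 P - 1` exchanges the diagonal and the antidiagonal
of `ℝ⁸ = ℝ⁴ × ℝ⁴`, and this is its matrix. -/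
def reflBlock (P : R44 →L[ℝ] R44) : H4 →L[ℝ] H4 :=
  fst4 ∘L ((2 : ℝ) • P - ContinuousLinearMap.id ℝ R44) ∘L (inl4 + inr4)

theorem continuous_reflBlock : Continuous reflBlock := by
  have h : Continuous fun P : R44 →L[ℝ] R44 => (2 : ℝ) • P - ContinuousLinearMap.id ℝ R44 := by
    fun_prop
  exact continuous_const.clm_comp (h.clm_comp continuous_const)

theorem reflBlock_apply (P : R44 →L[ℝ] R44) (u : H4) :
    reflBlock P u = (2 : ℝ) • (P (pair u u)).fst - u := by
  have h : (inl4 + inr4) u = pair u u := by apply pair_ext <;> simp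
  simp only [reflBlock, ContinuousLinearMap.comp_apply, h]
  rfl

theorem det_reflBlock_ne_zero (W : MaxIsotropic) : (reflBlock (proj W)).det ≠ 0 := by
  have hinj : Function.Injective (reflBlock (proj W)) := by
    refine (injective_iff_map_eq_zero _).2 fun u hu => ?_
    rw [reflBlock_apply] at hu
    set w : R44 := proj W (pair u u) with hw
    have hw1 : w ∈ W.1 := Submodule.starProjection_apply_mem _ _
    have hw2 : pair u u - w ∈ W.1ᗮ := Submodule.sub_starProjection_mem_orthogonal _
    rw [orthogonal_eq_map_swap] at hw2
    obtain ⟨w', hw', h⟩ := hw2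
    have h1 : w'.snd = u - w.fst := congrArg (fun z : R44 => z.fst) h
    have h2 : w'.fst = u - w.snd := congrArg (fun z : R44 => z.snd) h
    -- This difference is a diagonal vector `(a, a)`, on which `q` is `|a|²`; isotropy forces `a =
    -- 0`. The same remark then applies to `w`, which turns out to be diagonal too.
    have hd : w - w' ∈ W.1 := W.1.sub_mem hw1 hw'
    have hd1 : (w - w').fst = w.fst + w.snd - u := by
      change w.fst - w'.fst = _
      rw [h2]; abel
    have hd2 : (w - w').snd = w.fst + w.snd - u := by
      change w.snd - w'.snd = _
      rw [h1]; abel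
    have hq := W.2.2 _ hd
    rw [q_eq_inner, hd1, hd2, inner_self_eq_zero] at hq
    have h3 : w.fst = w.snd := by
      have : w.fst - w.snd = (2 : ℝ) • w.fst - u - (w.fst + w.snd - u) := by
        rw [two_smul]; abel
      rw [hu, hq, sub_zero] at this
      exact sub_eq_zero.1 this
    have hq' := W.2.2 _ hw1
    rw [q_eq_inner, ← h3, inner_self_eq_zero] at hq'
    rw [hq', smul_zero, zero_sub, neg_eq_zero] at hu
    exact hu
  exact (LinearEquiv.ofInjectiveEndo (reflBlock (proj W)).toLinearMap hinj).isUnit_det'.ne_zero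

theorem reflBlock_graphPlus : (reflBlock (proj (graphPlus 0 0))).det = 1 := by
  have h : reflBlock (proj (graphPlus 0 0)) = ContinuousLinearMap.id ℝ H4 := by
    ext1 u
    have hP : proj (graphPlus 0 0) (pair u u) = pair u 0 := by
      apply Submodule.eq_starProjection_of_mem_of_inner_eq_zero
      · rw [mem_graphPlus]
        change _ = skew 0 _
        rw [skew_zero]; rfl
      · intro z hz
        rw [mem_graphPlus] at hz
        change _ = skew 0 _ at hz
        rw [skew_zero] at hz
        rw [inner_R44, hz]
        change inner ℝ (u - u) _ + inner ℝ (u - 0) (0 : H4) = 0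
        rw [sub_self, inner_zero_left, inner_zero_right, add_zero]
    rw [reflBlock_apply, hP, pair_fst, two_smul, add_sub_cancel_right]
    rfl
  rw [h]
  exact LinearMap.det_id

theorem reflBlock_graphMinus : (reflBlock (proj (graphMinus 0 0))).det = -1 := by
  let e : H4 ≃ₗ[ℝ] E3 × ℝ := WithLp.linearEquiv 2 ℝ (E3 × ℝ)
  let f : E3 × ℝ →ₗ[ℝ] E3 × ℝ := LinearMap.prodMap LinearMap.id (-LinearMap.id)
  have h : (reflBlock (proj (graphMinus 0 0))).toLinearMap =
      e.symm.toLinearMap ∘ₗ f ∘ₗ e.toLinearMap := by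
    ext1 u
    have hP : proj (graphMinus 0 0) (pair u u) = pair (pt u.fst 0) (pt 0 u.snd) := by
      apply Submodule.eq_starProjection_of_mem_of_inner_eq_zero
      · refine ⟨(u.fst, u.snd), ?_⟩
        apply R44.ext' <;> simp [graphMinusMap, vec, cross]
      · rintro _ ⟨w, rfl⟩
        rw [inner_R44, inner_H4, inner_H4]
        simp [graphMinusMap, vec, cross]
    rw [ContinuousLinearMap.coe_coe, reflBlock_apply, hP]
    apply H4.ext'
    · change (2 : ℝ) • u.fst - u.fst = u.fst
      rw [two_smul, add_sub_cancel_right]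
    · change (2 : ℝ) • (0 : ℝ) - u.snd = -u.snd
      simp
  rw [ContinuousLinearMap.det, h]
  have := LinearMap.det_conj f e.symm
  rw [LinearEquiv.symm_symm] at this
  rw [this, LinearMap.det_prodMap]
  simp

/-- A continuous determinant that never vanishes cannot take both values `1` and `-1` on a connected
set. -/
theorem graphPlus_zero_notMem_Qminus : graphPlus 0 0 ∉ Qminus := by
  intro hmem
  have hc : Continuous fun W : MaxIsotropic => (reflBlock (proj W)).det :=
    ContinuousLinearMap.continuous_det.comp (continuous_reflBlock.comp continuous_induced_dom)
  have hpre : IsPreconnected Qminus := isPreconnected_connectedComponent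
  have h := hpre.image _ hc.continuousOn
  have h0 : (0 : ℝ) ∈ (fun W : MaxIsotropic => (reflBlock (proj W)).det) '' Qminus :=
    h.Icc_subset ⟨_, mem_connectedComponent, reflBlock_graphMinus⟩
      ⟨_, hmem, reflBlock_graphPlus⟩ ⟨by norm_num, by norm_num⟩
  obtain ⟨W, -, hW⟩ := h0
  exact det_reflBlock_ne_zero W hW

theorem disjoint_Qplus_Qminus {W : MaxIsotropic} (hp : W ∈ Qplus) (hm : W ∈ Qminus) : False := by
  have h1 : connectedComponent (graphPlus 0 0) = connectedComponent W := connectedComponent_eq hp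
  have h2 : connectedComponent (graphMinus 0 0) = connectedComponent W := connectedComponent_eq hm
  apply graphPlus_zero_notMem_Qminus
  rw [Qminus, h2, ← h1]
  exact mem_connectedComponent

theorem MaxIsotropic.eq_of_le {W W' : MaxIsotropic} (h : W.1 ≤ W'.1) : W = W' :=
  Subtype.ext (Submodule.eq_of_le_of_finrank_eq h (by rw [W.2.1, W'.2.1]))

/-! ### The two maximal isotropic subspaces through `V_p` -/

theorem eq_smul_of_forall_orthogonal {m w : H4}
    (h : ∀ u : H4, inner ℝ m u = 0 → inner ℝ u w = 0) : ∃ c : ℝ, w = c • m := by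
  have h1 : w ∈ (Submodule.span ℝ {m})ᗮᗮ := by
    rw [Submodule.mem_orthogonal]
    exact fun u hu => h u (Submodule.mem_orthogonal_singleton_iff_inner_right.1 hu)
  rw [Submodule.orthogonal_orthogonal, Submodule.mem_span_singleton] at h1
  obtain ⟨c, hc⟩ := h1
  exact ⟨c, hc.symm⟩

/-- There are exactly two maximal isotropic subspaces containing the isotropic subspace
`{(u, A u) | u ⊥ m}`. -/
theorem eq_graphPlus_or_eq_twisted {p : H4 × E3 × E3} (hp : p.1 ≠ 0) {W : MaxIsotropic}
    (hW : ∀ u : H4, inner ℝ p.1 u = 0 → pair u (skew p.2 u) ∈ W.1) :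
    W = graphPlus p.2.1 p.2.2 ∨ W = twisted p hp := by
  -- Orthogonality of `z` to all `(u, A u)`, `u ⊥ m`, for the polar form says that `z.snd - A z.fst`
  -- is orthogonal to `m^⊥`.
  have key : ∀ z ∈ W.1, ∃ c : ℝ, z.snd = skew p.2 z.fst + c • p.1 := by
    intro z hz
    obtain ⟨c, hc⟩ := eq_smul_of_forall_orthogonal (m := p.1) (w := z.snd - skew p.2 z.fst) (by
      intro u hu
      have h := inner_swap4_of_mem W (hW u hu) hz
      rw [inner_R44, swap4, pair_fst, pair_snd, pair_fst, pair_snd,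
        real_inner_comm z.fst] at h
      rw [inner_sub_right, inner_skew p.2 u z.fst]
      linarith)
    exact ⟨c, by rw [← hc]; abel⟩
  by_cases hz : ∀ z ∈ W.1, z.snd = skew p.2 z.fst
  · left
    apply MaxIsotropic.eq_of_le
    intro z h
    rw [mem_graphPlus]
    exact hz z h
  · right
    push Not at hz
    obtain ⟨z, hzW, hz⟩ := hz
    obtain ⟨c, hc⟩ := key z hzW
    have hc0 : c ≠ 0 := by
      rintro rfl
      rw [zero_smul, add_zero] at hc
      exact hz hc
    -- Since `A` is skew, `q z` reduces to `c (m · z.fst)`.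
    have hperp : inner ℝ p.1 z.fst = 0 := by
      have h := W.2.2 _ hzW
      rw [q_eq_inner, hc, inner_add_right, inner_skew_self, zero_add, inner_smul_right,
        mul_eq_zero, real_inner_comm] at h
      exact h.resolve_left hc0
    have h0 : pair 0 p.1 ∈ W.1 := by
      have h := W.1.smul_mem c⁻¹ (W.1.sub_mem hzW (hW _ hperp))
      convert h using 1
      apply pair_ext
      · change 0 = c⁻¹ • (z.fst - z.fst)
        rw [sub_self, smul_zero]
      · change p.1 = c⁻¹ • (z.snd - skew p.2 z.fst)
        rw [hc, add_sub_cancel_left, smul_smul, inv_mul_cancel₀ hc0, one_smul]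
    symm
    apply MaxIsotropic.eq_of_le
    intro z' hz'
    obtain ⟨h1, c', hc'⟩ := mem_twisted.1 hz'
    have h := W.1.add_mem (hW _ h1) (W.1.smul_mem c' h0)
    convert h using 1
    apply pair_ext
    · change z'.fst = z'.fst + c' • 0
      rw [smul_zero, add_zero]
    · exact hc'

/-! ### Vector algebra in `ℝ³` and the rotation vector -/

theorem inner_E3 (a b : E3) : inner ℝ a b = a 0 * b 0 + a 1 * b 1 + a 2 * b 2 := by
  simp [PiLp.inner_apply, Fin.sum_univ_three]
  ring

@[simp] theorem cross_apply_zero (a b : E3) : cross a b 0 = a 1 * b 2 - a 2 * b 1 := by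
  simp [cross, crossProduct]

@[simp] theorem cross_apply_one (a b : E3) : cross a b 1 = a 2 * b 0 - a 0 * b 2 := by
  simp [cross, crossProduct]

@[simp] theorem cross_apply_two (a b : E3) : cross a b 2 = a 0 * b 1 - a 1 * b 0 := by
  simp [cross, crossProduct]

theorem E3.ext' {a b : E3} (h0 : a 0 = b 0) (h1 : a 1 = b 1) (h2 : a 2 = b 2) : a = b := by
  ext i
  fin_cases i
  exacts [h0, h1, h2]

/-- The cross product as a continuous bilinear map. -/
def crossL : E3 →L[ℝ] E3 →L[ℝ] E3 :=
  LinearMap.toContinuousLinearMap (LinearMap.toContinuousLinearMap.toLinearMap ∘ₗ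
    LinearMap.mk₂ ℝ cross add_cross smul_cross cross_add (fun c a x => cross_smul a x c))

@[simp] theorem crossL_apply (a b : E3) : crossL a b = cross a b := rfl

theorem inner_cross_left (a b : E3) : inner ℝ (cross a b) a = 0 := by
  simp only [inner_E3, cross_apply_zero, cross_apply_one, cross_apply_two]; ring

theorem inner_cross_right (a b : E3) : inner ℝ (cross a b) b = 0 := by
  simp only [inner_E3, cross_apply_zero, cross_apply_one, cross_apply_two]; ring

theorem inner_cross_comm (a b c : E3) : inner ℝ (cross a b) c = -inner ℝ b (cross a c) := by
  simp only [inner_E3, cross_apply_zero, cross_apply_one, cross_apply_two]; ring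

theorem inner_cross_rotate (a b c : E3) : inner ℝ (cross a b) c = inner ℝ a (cross b c) := by
  simp only [inner_E3, cross_apply_zero, cross_apply_one, cross_apply_two]; ring

theorem cross_swap (a b : E3) : cross a b = -cross b a := by
  apply E3.ext' <;> simp <;> ring

/-- From `a × (a × b) = (a · b) a - |a|² b`; this form of collinearity needs no division. -/
theorem smul_eq_of_cross_eq_zero {a b : E3} (h : cross a b = 0) :
    (inner ℝ a a : ℝ) • b = (inner ℝ a b : ℝ) • a := by
  have h0 : a 1 * b 2 - a 2 * b 1 = 0 := by rw [← cross_apply_zero, h]; rfl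
  have h1 : a 2 * b 0 - a 0 * b 2 = 0 := by rw [← cross_apply_one, h]; rfl
  have h2 : a 0 * b 1 - a 1 * b 0 = 0 := by rw [← cross_apply_two, h]; rfl
  simp only [inner_E3]
  apply E3.ext' <;> simp only [PiLp.smul_apply, smul_eq_mul]
  · linear_combination a 2 * h1 - a 1 * h2
  · linear_combination a 0 * h2 - a 2 * h0
  · linear_combination a 1 * h0 - a 0 * h1

theorem eq_zero_of_forall_cross_eq_zero {a : E3} (h : ∀ x, cross a x = 0) : a = 0 := by
  have h0 : ∀ x : E3, cross a x = 0 → a 1 * x 2 - a 2 * x 1 = 0 ∧ a 2 * x 0 - a 0 * x 2 = 0 := by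
    intro x hx
    exact ⟨by rw [← cross_apply_zero, hx]; rfl, by rw [← cross_apply_one, hx]; rfl⟩
  have e2 := h0 (EuclideanSpace.single 2 1) (h _)
  have e1 := h0 (EuclideanSpace.single 1 1) (h _)
  simp at e1 e2
  exact E3.ext' (by simp [e2]) (by simp [e2]) (by simp [e1])

/-- Expansion of a vector in the frame `a, b, a × b`. -/
theorem normSq_cross_smul (a b x : E3) :
    (inner ℝ (cross a b) (cross a b) : ℝ) • x =
      (inner ℝ x (cross a b) : ℝ) • cross a b +
      (inner ℝ x a * inner ℝ b b - inner ℝ x b * inner ℝ a b : ℝ) • a +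
      (inner ℝ x b * inner ℝ a a - inner ℝ x a * inner ℝ a b : ℝ) • b := by
  simp only [inner_E3]
  apply E3.ext' <;>
    simp only [PiLp.smul_apply, PiLp.add_apply, smul_eq_mul, cross_apply_zero, cross_apply_one,
      cross_apply_two] <;> ring

/-- The vectors of the standard basis of the plane. -/
def bas (i : Fin 2) : E2 := EuclideanSpace.single i 1

theorem eq_bas (v : E2) : v = v 0 • bas 0 + v 1 • bas 1 := by
  ext i
  fin_cases i <;> simp [bas]

/-- The normal vector `F e₁ × F e₂` to the image of `F`. -/
def normalOf (F : E2 →L[ℝ] E3) : E3 := cross (F (bas 0)) (F (bas 1))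

theorem inner_normalOf (F : E2 →L[ℝ] E3) (v : E2) : inner ℝ (normalOf F) (F v) = 0 := by
  rw [eq_bas v, map_add, map_smul, map_smul, inner_add_right, inner_smul_right, inner_smul_right,
    normalOf, inner_cross_left, inner_cross_right]
  ring

theorem normalOf_ne_zero {F : E2 →L[ℝ] E3} (hF : Function.Injective F) : normalOf F ≠ 0 := by
  intro h
  have h1 := smul_eq_of_cross_eq_zero h
  rw [← map_smul, ← map_smul] at h1
  -- Injectivity gives `|F e₀|² e₁ = (F e₀ · F e₁) e₀`; the second coordinate yields `F e₀ = 0`.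
  have h2 := congrArg (fun v : E2 => v 1) (hF h1)
  simp only [bas, PiLp.smul_apply, smul_eq_mul] at h2
  simp at h2
  have h3 := hF (h2.trans (map_zero F).symm)
  have h4 := congrArg (fun v : E2 => v 0) h3
  simp at h4

theorem exists_eq_of_inner_normalOf {F : E2 →L[ℝ] E3} (hF : Function.Injective F) {x : E3}
    (hx : inner ℝ x (normalOf F) = 0) : ∃ v, F v = x := by
  have hn : (inner ℝ (normalOf F) (normalOf F) : ℝ) ≠ 0 :=
    inner_self_ne_zero.2 (normalOf_ne_zero hF)
  have h := normSq_cross_smul (F (bas 0)) (F (bas 1)) x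
  change (inner ℝ (normalOf F) (normalOf F) : ℝ) • x = (inner ℝ x (normalOf F) : ℝ) • _ + _ + _ at h
  rw [hx, zero_smul, zero_add, ← map_smul, ← map_smul, ← map_add] at h
  obtain ⟨v, hv⟩ : ∃ v, F v = (inner ℝ (normalOf F) (normalOf F) : ℝ) • x := ⟨_, h.symm⟩
  refine ⟨(inner ℝ (normalOf F) (normalOf F) : ℝ)⁻¹ • v, ?_⟩
  rw [map_smul, hv, smul_smul, inv_mul_cancel₀ hn, one_smul]

/-- The rotation vector `r` such that `G = r × F`, when `F · G = 0`. -/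
def rotOf (F G : E2 →L[ℝ] E3) : E3 :=
  -- The tangential part of the rotation accounts for the normal components of `G e₀` and `G e₁`,
  -- the normal part for the tangential components.
  (inner ℝ (normalOf F) (normalOf F) : ℝ)⁻¹ •
    ((inner ℝ (G (bas 1)) (normalOf F) : ℝ) • F (bas 0) -
      (inner ℝ (G (bas 0)) (normalOf F) : ℝ) • F (bas 1) +
      (inner ℝ (G (bas 0)) (F (bas 1)) : ℝ) • normalOf F)

theorem cross_rotOf {F G : E2 →L[ℝ] E3} (hF : Function.Injective F)
    (hFG : ∀ v, inner ℝ (F v) (G v) = 0) (v : E2) : cross (rotOf F G) (F v) = G v := by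
  have hn : (inner ℝ (normalOf F) (normalOf F) : ℝ) ≠ 0 :=
    inner_self_ne_zero.2 (normalOf_ne_zero hF)
  have h00 := hFG (bas 0)
  have h11 := hFG (bas 1)
  -- Polarization: `F e₀ · G e₁ + F e₁ · G e₀ = 0`.
  have h01 := hFG (bas 0 + bas 1)
  rw [map_add, map_add, inner_add_left, inner_add_right, inner_add_right, h00, h11] at h01
  have key : cross (rotOf F G) (F (bas 0)) = G (bas 0) ∧
      cross (rotOf F G) (F (bas 1)) = G (bas 1) := by
    rw [rotOf, smul_cross, smul_cross, inv_smul_eq_iff₀ hn, inv_smul_eq_iff₀ hn]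
    rw [normalOf]
    generalize F (bas 0) = a at *
    generalize F (bas 1) = b at *
    generalize G (bas 0) = c at *
    generalize G (bas 1) = d at *
    simp only [inner_E3] at h00 h11 h01 ⊢
    constructor
    · apply E3.ext' <;>
        simp only [PiLp.smul_apply, PiLp.add_apply, PiLp.sub_apply, smul_eq_mul, cross_apply_zero,
          cross_apply_one, cross_apply_two]
      · linear_combination (-a 0 * (b 0 * b 0 + b 1 * b 1 + b 2 * b 2)
          + b 0 * (a 0 * b 0 + a 1 * b 1 + a 2 * b 2)) * h00
      · linear_combination (-a 1 * (b 0 * b 0 + b 1 * b 1 + b 2 * b 2)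
          + b 1 * (a 0 * b 0 + a 1 * b 1 + a 2 * b 2)) * h00
      · linear_combination (-a 2 * (b 0 * b 0 + b 1 * b 1 + b 2 * b 2)
          + b 2 * (a 0 * b 0 + a 1 * b 1 + a 2 * b 2)) * h00
    · apply E3.ext' <;>
        simp only [PiLp.smul_apply, PiLp.add_apply, PiLp.sub_apply, smul_eq_mul, cross_apply_zero,
          cross_apply_one, cross_apply_two]
      · linear_combination (-b 0 * (a 0 * a 0 + a 1 * a 1 + a 2 * a 2)
          + a 0 * (a 0 * b 0 + a 1 * b 1 + a 2 * b 2)) * h11 +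
          (-a 0 * (b 0 * b 0 + b 1 * b 1 + b 2 * b 2)
          + b 0 * (a 0 * b 0 + a 1 * b 1 + a 2 * b 2)) * h01
      · linear_combination (-b 1 * (a 0 * a 0 + a 1 * a 1 + a 2 * a 2)
          + a 1 * (a 0 * b 0 + a 1 * b 1 + a 2 * b 2)) * h11 +
          (-a 1 * (b 0 * b 0 + b 1 * b 1 + b 2 * b 2)
          + b 1 * (a 0 * b 0 + a 1 * b 1 + a 2 * b 2)) * h01
      · linear_combination (-b 2 * (a 0 * a 0 + a 1 * a 1 + a 2 * a 2)
          + a 2 * (a 0 * b 0 + a 1 * b 1 + a 2 * b 2)) * h11 +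
          (-a 2 * (b 0 * b 0 + b 1 * b 1 + b 2 * b 2)
          + b 2 * (a 0 * b 0 + a 1 * b 1 + a 2 * b 2)) * h01
  rw [eq_bas v, map_add, map_add, map_smul, map_smul, map_smul, map_smul, cross_add, cross_smul,
    cross_smul, key.1, key.2]

/-! ### Integrability conditions of the rotation field -/

/-- An immersion `f` of a plane domain and an infinitesimal isometric deformation `g` of it. -/
structure LocalDeformation (Ω : Set E2) (f g : E2 → E3) : Prop where
  isOpen : IsOpen Ω
  contDiff_f : ContDiffOn ℝ ω f Ω
  contDiff_g : ContDiffOn ℝ ω g Ω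
  injective : ∀ x ∈ Ω, Function.Injective (fderiv ℝ f x)
  isometric : ∀ x ∈ Ω, ∀ v, inner ℝ (fderiv ℝ f x v) (fderiv ℝ g x v) = 0

/-- The normal vector field. -/
def normal (f : E2 → E3) (x : E2) : E3 := normalOf (fderiv ℝ f x)

/-- The rotation field of the deformation. -/
def rot (f g : E2 → E3) (x : E2) : E3 := rotOf (fderiv ℝ f x) (fderiv ℝ g x)

/-- The translation field of the deformation. -/
def trans (f g : E2 → E3) (x : E2) : E3 := g x - cross (rot f g x) (f x)

/-- The tangent plane, as a linear form on `ℝ³ × ℝ`. -/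
def conormal (f : E2 → E3) (x : E2) : H4 := pt (normal f x) (-inner ℝ (normal f x) (f x))

/-- The parameter of the subspace `φ₋`. -/
def minusPoint (f g : E2 → E3) (x : E2) : H4 × E3 × E3 :=
  (conormal f x, rot f g x, trans f g x)

/-- The second fundamental form is definite. -/
def IsElliptic (f : E2 → E3) (x : E2) : Prop :=
  ∀ v : E2, v ≠ 0 → inner ℝ (fderiv ℝ (fderiv ℝ f) x v v) (normal f x) ≠ 0

theorem zero_cross (a : E3) : cross 0 a = 0 := by simp [cross]

/-- `pt` as a linear map. -/
def ptL : E3 × ℝ →L[ℝ] H4 := (WithLp.prodContinuousLinearEquiv 2 ℝ E3 ℝ).symm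

theorem ContDiffOn.cross {n : WithTop ℕ∞} {X : Type*} [NormedAddCommGroup X] [NormedSpace ℝ X]
    {a b : X → E3} {U : Set X} (ha : ContDiffOn ℝ n a U) (hb : ContDiffOn ℝ n b U) :
    ContDiffOn ℝ n (fun x => Darboux.cross (a x) (b x)) U :=
  (crossL.contDiff.comp_contDiffOn ha).clm_apply hb

section Product

variable {a b : E2 → E3} {x : E2}

theorem fderiv_cross (ha : DifferentiableAt ℝ a x) (hb : DifferentiableAt ℝ b x) (v : E2) :
    fderiv ℝ (fun y => cross (a y) (b y)) x v =
      cross (a x) (fderiv ℝ b x v) + cross (fderiv ℝ a x v) (b x) := by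
  have h := crossL.fderiv_of_bilinear ha hb
  have h' := DFunLike.congr_fun h v
  simpa [ContinuousLinearMap.precompR, ContinuousLinearMap.precompL] using h'

theorem fderiv_apply_const {E : Type*} [NormedAddCommGroup E] [NormedSpace ℝ E]
    {a : E2 → E2 →L[ℝ] E} (ha : DifferentiableAt ℝ a x) (w v : E2) :
    fderiv ℝ (fun y => a y w) x v = fderiv ℝ a x v w := by
  have h := (ha.hasFDerivAt.clm_apply (hasFDerivAt_const w x)).fderiv
  rw [h]
  simp

end Product

namespace LocalDeformation

variable {Ω : Set E2} {f g : E2 → E3} (D : LocalDeformation Ω f g)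
include D

theorem contDiff_fderiv_f : ContDiffOn ℝ ω (fderiv ℝ f) Ω :=
  D.contDiff_f.fderiv_of_isOpen D.isOpen le_top

theorem contDiff_fderiv_g : ContDiffOn ℝ ω (fderiv ℝ g) Ω :=
  D.contDiff_g.fderiv_of_isOpen D.isOpen le_top

theorem contDiff_normal : ContDiffOn ℝ ω (normal f) Ω :=
  ContDiffOn.cross (D.contDiff_fderiv_f.clm_apply contDiffOn_const)
    (D.contDiff_fderiv_f.clm_apply contDiffOn_const)

theorem normal_ne_zero {x : E2} (hx : x ∈ Ω) : normal f x ≠ 0 :=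
  normalOf_ne_zero (D.injective x hx)

theorem contDiff_rot : ContDiffOn ℝ ω (rot f g) Ω := by
  have hf := fun i => D.contDiff_fderiv_f.clm_apply (contDiffOn_const (c := bas i))
  have hg := fun i => D.contDiff_fderiv_g.clm_apply (contDiffOn_const (c := bas i))
  have hn := D.contDiff_normal
  refine ((hn.inner ℝ hn).inv fun x hx => inner_self_ne_zero.2 (D.normal_ne_zero hx)).smul ?_
  exact ((((hg 1).inner ℝ hn).smul (hf 0)).sub (((hg 0).inner ℝ hn).smul (hf 1))).add
    (((hg 0).inner ℝ (hf 1)).smul hn)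

theorem contDiff_trans : ContDiffOn ℝ ω (trans f g) Ω :=
  D.contDiff_g.sub (ContDiffOn.cross D.contDiff_rot D.contDiff_f)

theorem contDiff_conormal : ContDiffOn ℝ ω (conormal f) Ω :=
  ptL.contDiff.comp_contDiffOn
    (D.contDiff_normal.prodMk (D.contDiff_normal.inner ℝ D.contDiff_f).neg)

theorem contDiff_minusPoint : ContDiffOn ℝ ω (minusPoint f g) Ω :=
  D.contDiff_conormal.prodMk (D.contDiff_rot.prodMk D.contDiff_trans)

theorem minusPoint_ne_zero {x : E2} (hx : x ∈ Ω) : (minusPoint f g x).1 ≠ 0 := fun h =>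
  D.normal_ne_zero hx (congrArg (fun u : H4 => u.fst) h)

theorem cross_rot {x : E2} (hx : x ∈ Ω) (v : E2) :
    cross (rot f g x) (fderiv ℝ f x v) = fderiv ℝ g x v :=
  cross_rotOf (D.injective x hx) (D.isometric x hx) v

theorem differentiableAt_of {E : Type*} [NormedAddCommGroup E] [NormedSpace ℝ E] {a : E2 → E}
    (ha : ContDiffOn ℝ ω a Ω) {x : E2} (hx : x ∈ Ω) : DifferentiableAt ℝ a x :=
  (ha.contDiffAt (D.isOpen.mem_nhds hx)).differentiableAt (by simp)

theorem fderiv_symm {a : E2 → E3}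
    (ha : ContDiffOn ℝ ω a Ω) {x : E2} (hx : x ∈ Ω) (v w : E2) :
    fderiv ℝ (fderiv ℝ a) x v w = fderiv ℝ (fderiv ℝ a) x w v :=
  (ha.contDiffAt (D.isOpen.mem_nhds hx)).isSymmSndFDerivAt_of_omega v w

/-- Differentiate `dg(w) = r × df(w)` along `v`; the second derivatives of `f` and `g` are
symmetric, so the remaining term is symmetric too. -/
theorem cross_fderiv_rot {x : E2} (hx : x ∈ Ω) (v w : E2) :
    cross (fderiv ℝ (rot f g) x v) (fderiv ℝ f x w) =
      cross (fderiv ℝ (rot f g) x w) (fderiv ℝ f x v) := by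
  have key : ∀ v w, fderiv ℝ (fderiv ℝ g) x v w =
      cross (rot f g x) (fderiv ℝ (fderiv ℝ f) x v w) +
        cross (fderiv ℝ (rot f g) x v) (fderiv ℝ f x w) := by
    intro v w
    have h : (fun y => fderiv ℝ g y w) =ᶠ[nhds x]
        fun y => cross (rot f g y) (fderiv ℝ f y w) := by
      filter_upwards [D.isOpen.mem_nhds hx] with y hy
      exact (D.cross_rot hy w).symm
    have h1 := DFunLike.congr_fun (h.fderiv_eq (𝕜 := ℝ)) v
    have hdf := D.differentiableAt_of D.contDiff_fderiv_f hx
    rw [fderiv_apply_const (D.differentiableAt_of D.contDiff_fderiv_g hx),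
      fderiv_cross (D.differentiableAt_of D.contDiff_rot hx)
        (hdf.clm_apply (differentiableAt_const w)), fderiv_apply_const hdf] at h1
    exact h1
  have h1 := key v w
  rw [D.fderiv_symm D.contDiff_g hx, key w v, D.fderiv_symm D.contDiff_f hx] at h1
  exact (add_left_cancel h1).symm

/-- Pair `dr(v) × df(w) = dr(w) × df(v)` with `df(v)`: the right side vanishes, and the left is a
triple product containing `df(v) × df(w)`. -/
theorem inner_fderiv_rot_normal {x : E2} (hx : x ∈ Ω) (v : E2) :
    inner ℝ (fderiv ℝ (rot f g) x v) (normal f x) = 0 := by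
  have key : ∀ v w, inner ℝ (fderiv ℝ (rot f g) x v)
      (cross (fderiv ℝ f x v) (fderiv ℝ f x w)) = 0 := by
    intro v w
    rw [← inner_cross_rotate, D.cross_fderiv_rot hx v v, D.cross_fderiv_rot hx v v,
      inner_cross_rotate]
    have h := congrArg (fun u => inner ℝ u (fderiv ℝ f x v)) (D.cross_fderiv_rot hx v w)
    simp only [inner_cross_right] at h
    rw [inner_cross_rotate] at h
    rw [cross_swap, inner_neg_right, h, neg_zero]
  rw [eq_bas v, map_add, map_smul, map_smul, inner_add_left, inner_smul_left, inner_smul_left]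
  have h0 := key (bas 0) (bas 1)
  have h1 := key (bas 1) (bas 0)
  rw [cross_swap, inner_neg_right, neg_eq_zero] at h1
  change inner ℝ _ (normal f x) = 0 at h0
  change inner ℝ _ (normal f x) = 0 at h1
  rw [h0, h1]
  simp

/-- The Weingarten relation, by differentiating `df(w) · n = 0`. -/
theorem inner_fderiv_normal {x : E2} (hx : x ∈ Ω) (v w : E2) :
    inner ℝ (fderiv ℝ f x w) (fderiv ℝ (normal f) x v) =
      -inner ℝ (fderiv ℝ (fderiv ℝ f) x v w) (normal f x) := by
  have h : (fun y => inner ℝ (fderiv ℝ f y w) (normal f y)) =ᶠ[nhds x] fun _ => (0 : ℝ) := by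
    filter_upwards with y
    rw [real_inner_comm]
    exact inner_normalOf _ _
  have h1 := DFunLike.congr_fun (h.fderiv_eq (𝕜 := ℝ)) v
  have hdf := D.differentiableAt_of D.contDiff_fderiv_f hx
  rw [fderiv_inner_apply ℝ (hdf.clm_apply (differentiableAt_const w))
    (D.differentiableAt_of D.contDiff_normal hx), fderiv_apply_const hdf] at h1
  simp only [fderiv_fun_const, Pi.zero_apply, zero_apply] at h1
  linarith

/-- Differentiating `dr(w) · n = 0` expresses both sides through the symmetric second derivative of
`r`. -/
theorem inner_fderiv_rot_fderiv_normal {x : E2} (hx : x ∈ Ω) (v w : E2) :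
    inner ℝ (fderiv ℝ (rot f g) x v) (fderiv ℝ (normal f) x w) =
      inner ℝ (fderiv ℝ (rot f g) x w) (fderiv ℝ (normal f) x v) := by
  have hdr : ContDiffOn ℝ ω (fderiv ℝ (rot f g)) Ω :=
    D.contDiff_rot.fderiv_of_isOpen D.isOpen le_top
  have hdr' := D.differentiableAt_of hdr hx
  have key : ∀ v w, inner ℝ (fderiv ℝ (rot f g) x w) (fderiv ℝ (normal f) x v) =
      -inner ℝ (fderiv ℝ (fderiv ℝ (rot f g)) x v w) (normal f x) := by
    intro v w
    have h : (fun y => inner ℝ (fderiv ℝ (rot f g) y w) (normal f y)) =ᶠ[nhds x]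
        fun _ => (0 : ℝ) := by
      filter_upwards [D.isOpen.mem_nhds hx] with y hy
      exact D.inner_fderiv_rot_normal hy w
    have h1 := DFunLike.congr_fun (h.fderiv_eq (𝕜 := ℝ)) v
    rw [fderiv_inner_apply ℝ (hdr'.clm_apply (differentiableAt_const w))
      (D.differentiableAt_of D.contDiff_normal hx), fderiv_apply_const hdr'] at h1
    simp only [fderiv_fun_const, Pi.zero_apply, zero_apply] at h1
    linarith
  rw [key v w, key w v, D.fderiv_symm D.contDiff_rot hx]

/-- At an elliptic point, a rotation field that is not an immersion is critical. -/
theorem fderiv_rot_eq_zero_of_isElliptic {x : E2} (hx : x ∈ Ω) (he : IsElliptic f x) {v : E2}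
    (hv : v ≠ 0) (h : fderiv ℝ (rot f g) x v = 0) : fderiv ℝ (rot f g) x = 0 := by
  ext1 w
  set a := fderiv ℝ f x v with ha
  set b := fderiv ℝ (rot f g) x w with hb
  have ha0 : a ≠ 0 := fun h0 => hv (D.injective x hx (h0.trans (map_zero _).symm))
  have haa : (inner ℝ a a : ℝ) ≠ 0 := inner_self_ne_zero.2 ha0
  -- Thus `dr(w)` is a multiple of `df(v)`. Pairing with `dn(v)` shows the multiple is zero: `dr(w)
  -- · dn(v) = dr(v) · dn(w) = 0`, while `df(v) · dn(v) ≠ 0` by ellipticity.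
  have h1 : cross a b = 0 := by
    rw [cross_swap, hb, ha, D.cross_fderiv_rot hx, h, zero_cross, neg_zero]
  have h2 := smul_eq_of_cross_eq_zero h1
  have h3 := congrArg (fun u => inner ℝ u (fderiv ℝ (normal f) x v)) h2
  simp only [inner_smul_left] at h3
  rw [hb, D.inner_fderiv_rot_fderiv_normal hx, h, inner_zero_left, mul_zero, ha,
    D.inner_fderiv_normal hx] at h3
  have h4 := (mul_eq_zero.1 h3.symm).resolve_right (neg_ne_zero.2 (he v hv))
  have h5 : (inner ℝ a b : ℝ) = 0 := by simpa using h4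
  rw [h5, zero_smul, smul_eq_zero] at h2
  exact h2.resolve_left haa

/-- The terms `dg` and `r × df` cancel, so the translation field is critical wherever the rotation
field is. -/
theorem fderiv_trans {x : E2} (hx : x ∈ Ω) (v : E2) :
    fderiv ℝ (trans f g) x v = -cross (fderiv ℝ (rot f g) x v) (f x) := by
  have hf := D.differentiableAt_of D.contDiff_f hx
  have hr := D.differentiableAt_of D.contDiff_rot hx
  have hc := D.differentiableAt_of (ContDiffOn.cross D.contDiff_rot D.contDiff_f) hx
  have h : fderiv ℝ (trans f g) x =
      fderiv ℝ g x - fderiv ℝ (fun y => cross (rot f g y) (f y)) x :=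
    fderiv_fun_sub (D.differentiableAt_of D.contDiff_g hx) hc
  rw [h, sub_apply, fderiv_cross hr hf, D.cross_rot hx]
  abel

/-- Nonvanishing is an open condition, uniformly over the compact unit circle, and homogeneity
extends it to all nonzero `v`. -/
theorem isElliptic_eventually {x : E2} (hx : x ∈ Ω) (he : IsElliptic f x) :
    ∀ᶠ y in nhds x, IsElliptic f y := by
  have h2 : ContDiffOn ℝ ω (fderiv ℝ (fderiv ℝ f)) Ω :=
    D.contDiff_fderiv_f.fderiv_of_isOpen D.isOpen le_top
  have hK : IsCompact (Metric.sphere (0 : E2) 1) := isCompact_sphere _ _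
  have h := hK.eventually_forall_of_forall_eventually (x₀ := x)
    (P := fun y v => inner ℝ (fderiv ℝ (fderiv ℝ f) y v v) (normal f y) ≠ 0) (by
      intro v hv
      have hv0 : v ≠ 0 := by
        rintro rfl
        simp at hv
      have hc1 : ContinuousAt (fderiv ℝ (fderiv ℝ f)) x :=
        h2.continuousOn.continuousAt (D.isOpen.mem_nhds hx)
      have hc2 : ContinuousAt (normal f) x :=
        D.contDiff_normal.continuousOn.continuousAt (D.isOpen.mem_nhds hx)
      have hc1' : ContinuousAt (fun z : E2 × E2 => fderiv ℝ (fderiv ℝ f) z.1) (x, v) :=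
        hc1.comp_of_eq continuousAt_fst rfl
      have hc2' : ContinuousAt (fun z : E2 × E2 => normal f z.1) (x, v) :=
        hc2.comp_of_eq continuousAt_fst rfl
      have hc : ContinuousAt (fun z : E2 × E2 =>
          inner ℝ (fderiv ℝ (fderiv ℝ f) z.1 z.2 z.2) (normal f z.1)) (x, v) :=
        ((hc1'.clm_apply continuousAt_snd).clm_apply continuousAt_snd).inner hc2'
      exact hc.eventually_ne (he v hv0))
  filter_upwards [h] with y hy v hv
  have hn : ‖v‖ ≠ 0 := norm_ne_zero_iff.2 hv
  have h1 := hy (‖v‖⁻¹ • v) (by simp [norm_smul, hn])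
  rw [map_smul, map_smul, smul_apply, inner_smul_left, inner_smul_left] at h1
  intro h0
  rw [h0, mul_zero, mul_zero] at h1
  exact h1 rfl

end LocalDeformation

/-! ### Elliptic points and the differentials of `φ₊` and `φ₋` in a chart -/

theorem fderiv_fderiv_nonpos_of_isLocalMax {N : E2 → ℝ} {x : E2} (hN : ContDiffAt ℝ 2 N x)
    (hmax : IsLocalMax N x) (v : E2) : fderiv ℝ (fderiv ℝ N) x v v ≤ 0 := by
  by_contra! hpos
  set l : ℝ → E2 := fun t => x + t • v with hl
  have hl0 : l 0 = x := by simp [hl]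
  have hlc : Continuous l := by fun_prop
  have hld : ∀ t, HasDerivAt l v t := fun t => by
    have h := ((hasDerivAt_id t).smul_const v).const_add x
    rw [one_smul] at h
    exact h
  have hlt : Filter.Tendsto l (nhds 0) (nhds x) := hl0 ▸ hlc.continuousAt
  have hdiff : ∀ᶠ t in nhds 0, DifferentiableAt ℝ N (l t) := by
    have : ∀ᶠ y in nhds x, ContDiffAt ℝ 2 N y := hN.eventually (by simp)
    exact hlt.eventually (this.mono fun y hy => hy.differentiableAt (by simp))
  have hd1 : deriv (N ∘ l) =ᶠ[nhds 0] fun t => fderiv ℝ N (l t) v := by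
    filter_upwards [hdiff] with t ht
    exact (ht.hasFDerivAt.comp_hasDerivAt t (hld t)).deriv
  have hN' : DifferentiableAt ℝ (fderiv ℝ N) (l 0) := by
    rw [hl0]
    exact (hN.fderiv_right (m := 1) (by norm_num)).differentiableAt (by simp)
  have hd2 : deriv (deriv (N ∘ l)) 0 = fderiv ℝ (fderiv ℝ N) x v v := by
    rw [hd1.deriv_eq]
    have h := ((hN'.hasFDerivAt.comp_hasDerivAt 0 (hld 0)).clm_apply (hasDerivAt_const 0 v)).deriv
    rw [hl0] at h
    simpa using h
  have hmax' : IsLocalMax (N ∘ l) 0 := by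
    have h : ∀ᶠ y in nhds x, N y ≤ N x := hmax
    have h' : ∀ᶠ t in nhds 0, N (l t) ≤ N (l 0) := by rw [hl0]; exact hlt.eventually h
    exact h'
  have hcont : ContinuousAt (N ∘ l) 0 :=
    ContinuousAt.comp (by rw [hl0]; exact hN.continuousAt) hlc.continuousAt
  -- A positive second derivative would make the maximum a minimum as well, so `N` would be constant
  -- along the line near `x`, with zero second derivative.
  have hmin : IsLocalMin (N ∘ l) 0 :=
    isLocalMin_of_deriv_deriv_pos (by rw [hd2]; exact hpos) hmax'.deriv_eq_zero hcont
  have hconst : (N ∘ l) =ᶠ[nhds 0] fun _ => (N ∘ l) 0 := by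
    filter_upwards [hmax', hmin] with t h1 h2
    exact le_antisymm h1 h2
  have h1 : deriv (N ∘ l) =ᶠ[nhds 0] fun _ => 0 := by
    have := hconst.deriv
    simpa using this
  have h2 : deriv (deriv (N ∘ l)) 0 = 0 := by
    rw [h1.deriv_eq]; simp
  rw [hd2] at h2
  exact hpos.ne' h2

/-- `ψ` on a plane domain. -/
def lift (f g : E2 → E3) (x : E2) : R44 := vec (f x) 1 (g x) (-inner ℝ (f x) (g x))

/-- `pair` as a continuous linear map. -/
def pairL : H4 × H4 →L[ℝ] R44 := (WithLp.prodContinuousLinearEquiv 2 ℝ H4 H4).symm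

section Projection

variable {W : E2 → MaxIsotropic} {x v : E2}

/-- A section of a family of subspaces that is stationary in a direction has its derivative in that
direction in the subspace. -/
theorem fderiv_mem_of_fderiv_proj_eq_zero {P : E2 → R44 →L[ℝ] R44} {s : E2 → R44}
    (hP : DifferentiableAt ℝ P x) (hPW : ∀ᶠ y in nhds x, P y = proj (W y))
    (hs : DifferentiableAt ℝ s x) (hsW : ∀ᶠ y in nhds x, s y ∈ (W y).1)
    (h : fderiv ℝ P x v = 0) : fderiv ℝ s x v ∈ (W x).1 := by
  have hev : s =ᶠ[nhds x] fun y => P y (s y) := by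
    filter_upwards [hPW, hsW] with y h1 h2
    rw [h1]
    exact (Submodule.starProjection_eq_self_iff.2 h2).symm
  have h1 := DFunLike.congr_fun (hev.fderiv_eq (𝕜 := ℝ)) v
  rw [(hP.hasFDerivAt.clm_apply hs.hasFDerivAt).fderiv] at h1
  simp only [add_apply, ContinuousLinearMap.comp_apply, ContinuousLinearMap.flip_apply, h,
    zero_apply, add_zero, hPW.self_of_nhds] at h1
  exact Submodule.starProjection_eq_self_iff.1 h1.symm

end Projection

namespace LocalDeformation

variable {Ω : Set E2} {f g : E2 → E3} (D : LocalDeformation Ω f g)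
include D

theorem isElliptic_of_isLocalMax {x : E2} (hx : x ∈ Ω)
    (hmax : IsLocalMax (fun y => (inner ℝ (f y) (f y) : ℝ)) x) : IsElliptic f x := by
  intro v hv h0
  have hfx := D.differentiableAt_of D.contDiff_f hx
  have hdf := D.differentiableAt_of D.contDiff_fderiv_f hx
  have hN : ContDiffOn ℝ ω (fun y => (inner ℝ (f y) (f y) : ℝ)) Ω :=
    D.contDiff_f.inner ℝ D.contDiff_f
  have hNx := D.differentiableAt_of (hN.fderiv_of_isOpen D.isOpen le_top) hx
  have hd1 : ∀ y ∈ Ω, ∀ w, fderiv ℝ (fun y => (inner ℝ (f y) (f y) : ℝ)) y w =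
      2 * inner ℝ (f y) (fderiv ℝ f y w) := by
    intro y hy w
    have hfy := D.differentiableAt_of D.contDiff_f hy
    rw [fderiv_inner_apply ℝ hfy hfy, real_inner_comm (fderiv ℝ f y w)]
    ring
  have hperp : ∀ w, inner ℝ (f x) (fderiv ℝ f x w) = 0 := by
    intro w
    have h := hd1 x hx w
    rw [hmax.fderiv_eq_zero, zero_apply] at h
    linarith
  have hd2 : fderiv ℝ (fderiv ℝ (fun y => (inner ℝ (f y) (f y) : ℝ))) x v v =
      2 * (inner ℝ (f x) (fderiv ℝ (fderiv ℝ f) x v v) +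
        inner ℝ (fderiv ℝ f x v) (fderiv ℝ f x v)) := by
    rw [← fderiv_apply_const hNx]
    have hev : (fun y => fderiv ℝ (fun y => (inner ℝ (f y) (f y) : ℝ)) y v) =ᶠ[nhds x]
        fun y => 2 * inner ℝ (f y) (fderiv ℝ f y v) := by
      filter_upwards [D.isOpen.mem_nhds hx] with y hy
      exact hd1 y hy v
    have hdv : DifferentiableAt ℝ (fun y => fderiv ℝ f y v) x :=
      hdf.clm_apply (differentiableAt_const v)
    rw [hev.fderiv_eq, fderiv_const_mul (hfx.inner ℝ hdv), smul_apply,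
      fderiv_inner_apply ℝ hfx hdv, fderiv_apply_const hdf, smul_eq_mul]
  have hle := fderiv_fderiv_nonpos_of_isLocalMax
    ((hN.contDiffAt (D.isOpen.mem_nhds hx)).of_le le_top) hmax v
  rw [hd2] at hle
  -- At the maximum `f` is orthogonal to the tangent plane, hence a multiple of `n`. If the second
  -- fundamental form vanished on `(v, v)`, the Hessian of `|f|²` there would be `2 |df(v)|²`, which
  -- must be `≤ 0`.
  have hexp := normSq_cross_smul (fderiv ℝ f x (bas 0)) (fderiv ℝ f x (bas 1)) (f x)
  rw [hperp, hperp] at hexp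
  change (inner ℝ (normal f x) (normal f x) : ℝ) • f x =
    (inner ℝ (f x) (normal f x) : ℝ) • normal f x + _ + _ at hexp
  have h1 := congrArg (fun u => inner ℝ u (fderiv ℝ (fderiv ℝ f) x v v)) hexp
  simp only [zero_mul, sub_zero, zero_smul, add_zero, inner_smul_left] at h1
  rw [real_inner_comm (fderiv ℝ (fderiv ℝ f) x v v) (normal f x), h0, mul_zero] at h1
  have hn : (inner ℝ (normal f x) (normal f x) : ℝ) ≠ 0 :=
    inner_self_ne_zero.2 (D.normal_ne_zero hx)
  have h2 : (inner ℝ (f x) (fderiv ℝ (fderiv ℝ f) x v v) : ℝ) = 0 :=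
    (mul_eq_zero.1 h1).resolve_left (by simpa using hn)
  have h3 : (inner ℝ (fderiv ℝ f x v) (fderiv ℝ f x v) : ℝ) ≤ 0 := by linarith
  have h4 := inner_self_eq_zero.1 (le_antisymm h3 real_inner_self_nonneg)
  exact hv (D.injective x hx (h4.trans (map_zero _).symm))

theorem fderiv_lift {x : E2} (hx : x ∈ Ω) (v : E2) :
    DifferentiableAt ℝ (lift f g) x ∧ fderiv ℝ (lift f g) x v =
      vec (fderiv ℝ f x v) 0 (fderiv ℝ g x v)
        (-(inner ℝ (f x) (fderiv ℝ g x v) + inner ℝ (fderiv ℝ f x v) (g x))) := by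
  have hf := (D.differentiableAt_of D.contDiff_f hx)
  have hg := (D.differentiableAt_of D.contDiff_g hx)
  have h1 : HasFDerivAt (fun y => ptL (f y, 1)) _ x :=
    ptL.hasFDerivAt.comp x (hf.hasFDerivAt.prodMk (hasFDerivAt_const (1 : ℝ) x))
  have h2 : HasFDerivAt (fun y => ptL (g y, -inner ℝ (f y) (g y))) _ x :=
    ptL.hasFDerivAt.comp x (hg.hasFDerivAt.prodMk (hf.inner ℝ hg).hasFDerivAt.neg)
  have h3 : HasFDerivAt (lift f g) _ x := pairL.hasFDerivAt.comp x (h1.prodMk h2)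
  refine ⟨h3.differentiableAt, ?_⟩
  rw [h3.fderiv]
  apply R44.ext'
  · rfl
  · rfl
  · rfl
  · change -(fderiv ℝ (fun y => (inner ℝ (f y) (g y) : ℝ)) x v) = _
    rw [fderiv_inner_apply ℝ hf hg]
    rfl

/-- The tangent projective plane of the lift is `{(u, A u) | u ⊥ m}`. -/
theorem mem_tangent {x : E2} (hx : x ∈ Ω) (z : R44) :
    z ∈ Submodule.span ℝ {lift f g x} ⊔ LinearMap.range (fderiv ℝ (lift f g) x).toLinearMap ↔
      inner ℝ (conormal f x) z.fst = 0 ∧ z.snd = skew (rot f g x, trans f g x) z.fst := by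
  -- The last coordinate uses `f · dg(v) = -t · df(v)` up to the rotation term, namely `(r × f) ·
  -- df(v) = -f · (r × df(v))`.
  have hform : ∀ (c : ℝ) (v : E2), c • lift f g x + fderiv ℝ (lift f g) x v =
      pair (pt (c • f x + fderiv ℝ f x v) c)
        (skew (rot f g x, trans f g x) (pt (c • f x + fderiv ℝ f x v) c)) := by
    intro c v
    rw [(D.fderiv_lift hx v).2, skew_apply]
    have hself : inner ℝ (cross (rot f g x) (f x)) (f x) = 0 := inner_cross_right _ _
    apply R44.ext'
    · rfl
    · change c * 1 + 0 = c
      ring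
    · change c • g x + fderiv ℝ g x v = cross (rot f g x) (c • f x + fderiv ℝ f x v) +
        c • (g x - cross (rot f g x) (f x))
      rw [cross_add, cross_smul, D.cross_rot hx, smul_sub]
      abel
    · change c * -inner ℝ (f x) (g x) +
        -(inner ℝ (f x) (fderiv ℝ g x v) + inner ℝ (fderiv ℝ f x v) (g x)) =
        -inner ℝ (g x - cross (rot f g x) (f x)) (c • f x + fderiv ℝ f x v)
      rw [inner_sub_left, inner_add_right, inner_add_right, inner_smul_right, inner_smul_right,
        hself, inner_cross_comm, D.cross_rot hx, real_inner_comm (g x),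
        real_inner_comm (g x)]
      ring
  have hperp : ∀ (c : ℝ) (v : E2),
      inner ℝ (conormal f x) (pt (c • f x + fderiv ℝ f x v) c) = 0 := by
    intro c v
    rw [inner_H4, conormal, pt_fst, pt_snd, pt_fst, pt_snd, inner_add_right, inner_smul_right,
      normal, inner_normalOf]
    ring
  rw [Submodule.mem_sup]
  constructor
  · rintro ⟨a, ha, _, ⟨v, rfl⟩, rfl⟩
    obtain ⟨c, rfl⟩ := Submodule.mem_span_singleton.1 ha
    rw [ContinuousLinearMap.coe_coe, hform]
    exact ⟨hperp c v, rfl⟩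
  · rintro ⟨h1, h2⟩
    have h3 : inner ℝ (z.fst.fst - z.fst.snd • f x) (normal f x) = 0 := by
      rw [inner_H4, conormal, pt_fst, pt_snd] at h1
      rw [inner_sub_left, inner_smul_left, real_inner_comm, real_inner_comm (normal f x) (f x)]
      simp only [conj_trivial]
      linarith
    obtain ⟨v, hv⟩ := exists_eq_of_inner_normalOf (D.injective x hx) h3
    refine ⟨z.fst.snd • lift f g x, Submodule.smul_mem _ _ (Submodule.mem_span_singleton_self _),
      _, ⟨v, rfl⟩, ?_⟩
    have h4 : pt (z.fst.snd • f x + fderiv ℝ f x v) z.fst.snd = z.fst := by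
      apply H4.ext'
      · rw [pt_fst, hv]; abel
      · rfl
    rw [ContinuousLinearMap.coe_coe, hform, h4, ← h2]
    rfl

/-- The family `φ₊` on a plane domain. -/
theorem contDiff_plus :
    ContDiffOn ℝ ω (fun y => proj (graphPlus (rot f g y) (trans f g y))) Ω :=
  ContDiff.comp_contDiffOn (g := fun ab : E3 × E3 => proj (graphPlus ab.1 ab.2))
    (f := fun y => (rot f g y, trans f g y)) contDiff_proj_graphPlus
    (D.contDiff_rot.prodMk D.contDiff_trans)

theorem contDiff_minus : ContDiffOn ℝ ω (fun y =>
    (LinearMap.range (minusParam (minusPoint f g y)).toLinearMap).starProjection) Ω :=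
  contDiffOn_proj_twisted.comp D.contDiff_minusPoint fun _ hy => D.minusPoint_ne_zero hy

/-- The sections `(u, A u)` with `u = (a, 0)` constant have derivative `(0, A'(v) u)`. In a graph
this forces `A'(v) u = 0`, whose `ℝ³` part is `dr(v) × a`. -/
theorem fderiv_rot_eq_zero_of_fderiv_plus {x v : E2} (hx : x ∈ Ω)
    (h : fderiv ℝ (fun y => proj (graphPlus (rot f g y) (trans f g y))) x v = 0) :
    fderiv ℝ (rot f g) x v = 0 := by
  have hr := D.differentiableAt_of D.contDiff_rot hx
  have ht := D.differentiableAt_of D.contDiff_trans hx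
  have hsk : DifferentiableAt ℝ (fun y => skew (rot f g y, trans f g y)) x :=
    (contDiff_skew (n := 1)).differentiable (by simp) |>.differentiableAt.comp x (hr.prodMk ht)
  have hskd : fderiv ℝ (fun y => skew (rot f g y, trans f g y)) x v =
      skew (fderiv ℝ (rot f g) x v, fderiv ℝ (trans f g) x v) := by
    let T : E3 × E3 →L[ℝ] H4 →L[ℝ] H4 := LinearMap.toContinuousLinearMap
      (LinearMap.toContinuousLinearMap.toLinearMap ∘ₗ skewLin)
    have h1 : HasFDerivAt (fun y => T (rot f g y, trans f g y)) _ x :=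
      T.hasFDerivAt.comp x (hr.hasFDerivAt.prodMk ht.hasFDerivAt)
    exact DFunLike.congr_fun h1.fderiv v
  apply eq_zero_of_forall_cross_eq_zero
  intro a
  have hsu : HasFDerivAt (fun y => skew (rot f g y, trans f g y) (pt a 0)) _ x :=
    hsk.hasFDerivAt.clm_apply (hasFDerivAt_const (pt a 0) x)
  have hs : HasFDerivAt (fun y => pairL (pt a 0, skew (rot f g y, trans f g y) (pt a 0))) _ x :=
    pairL.hasFDerivAt.comp x ((hasFDerivAt_const (pt a 0) x).prodMk hsu)
  have hmem := fderiv_mem_of_fderiv_proj_eq_zero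
    (W := fun y => graphPlus (rot f g y) (trans f g y))
    (D.differentiableAt_of D.contDiff_plus hx) (Filter.Eventually.of_forall fun _ => rfl)
    hs.differentiableAt (Filter.Eventually.of_forall fun y => mem_graphPlus.2 rfl) h
  rw [hs.fderiv, mem_graphPlus] at hmem
  have h2 : skew (fderiv ℝ (rot f g) x v, fderiv ℝ (trans f g) x v) (pt a 0) = 0 := by
    have hmem' : skew (rot f g x, trans f g x) 0 +
        fderiv ℝ (fun y => skew (rot f g y, trans f g y)) x v (pt a 0) =
        skew (rot f g x, trans f g x) 0 := hmem
    rw [map_zero, zero_add, hskd] at hmem'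
    exact hmem'
  have h3 := congrArg (fun u : H4 => u.fst) h2
  rw [skew_apply] at h3
  simpa using h3

/-- Take the section `(u, A u)` with `u = (df(v), 0)`. Its derivative along `v` can stay in the
subspace only if `d²f(v, v)` is tangent, which ellipticity excludes for `v ≠ 0`. -/
theorem eq_zero_of_fderiv_minus {x v : E2} (hx : x ∈ Ω) (he : IsElliptic f x)
    (h : fderiv ℝ (fun y =>
      (LinearMap.range (minusParam (minusPoint f g y)).toLinearMap).starProjection) x v = 0) :
    v = 0 := by
  by_contra hv
  apply he v hv
  have hnhds := D.isOpen.mem_nhds hx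
  have hr := D.differentiableAt_of D.contDiff_rot hx
  have ht := D.differentiableAt_of D.contDiff_trans hx
  have hdf := D.differentiableAt_of D.contDiff_fderiv_f hx
  have hsk : DifferentiableAt ℝ (fun y => skew (rot f g y, trans f g y)) x :=
    (contDiff_skew (n := 1)).differentiable (by simp) |>.differentiableAt.comp x (hr.prodMk ht)
  have hpt : HasFDerivAt (fun y => ptL (fderiv ℝ f y v, 0)) _ x :=
    ptL.hasFDerivAt.comp x ((hdf.hasFDerivAt.clm_apply (hasFDerivAt_const v x)).prodMk
      (hasFDerivAt_const (0 : ℝ) x))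
  have hs : HasFDerivAt (fun y => pairL (ptL (fderiv ℝ f y v, 0),
      skew (rot f g y, trans f g y) (ptL (fderiv ℝ f y v, 0)))) _ x :=
    pairL.hasFDerivAt.comp x (hpt.prodMk (hsk.hasFDerivAt.clm_apply hpt))
  -- The value where `m = 0` is arbitrary: `m` does not vanish on `Ω`, and only points near `x`
  -- matter.
  let W : E2 → MaxIsotropic := fun y =>
    if hy : (minusPoint f g y).1 ≠ 0 then twisted (minusPoint f g y) hy else graphPlus 0 0
  have hW : ∀ (y) (hy : y ∈ Ω), W y = twisted (minusPoint f g y) (D.minusPoint_ne_zero hy) := fun y hy =>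
    dif_pos (D.minusPoint_ne_zero hy)
  have hmem := fderiv_mem_of_fderiv_proj_eq_zero (W := W)
    (D.differentiableAt_of D.contDiff_minus hx) (by
      filter_upwards [hnhds] with y hy
      rw [hW y hy]
      rfl)
    hs.differentiableAt (by
      filter_upwards [hnhds] with y hy
      rw [hW y hy, mem_twisted]
      refine ⟨?_, 0, ?_⟩
      · change inner ℝ (conormal f y) (pt (fderiv ℝ f y v) 0) = 0
        rw [inner_H4, conormal, pt_fst, pt_snd, pt_fst, pt_snd, normal, inner_normalOf]
        ring
      · rw [zero_smul, add_zero]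
        rfl) h
  rw [hs.fderiv, hW x hx, mem_twisted] at hmem
  have h1 := hmem.1
  rw [inner_H4] at h1
  have h2 : inner ℝ (normal f x) (fderiv ℝ f x 0 + fderiv ℝ (fderiv ℝ f) x v v) +
    -inner ℝ (normal f x) (f x) * 0 = 0 := h1
  rw [map_zero, zero_add, mul_zero, add_zero, real_inner_comm] at h2
  exact h2

/-- Near an elliptic point where `φ₊` is everywhere critical, it is constant. -/
theorem plus_eventually_const {x : E2} (hx : x ∈ Ω) (he : IsElliptic f x)
    (h : ∀ᶠ y in nhds x, ∃ v ≠ 0,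
      fderiv ℝ (fun y => proj (graphPlus (rot f g y) (trans f g y))) y v = 0) :
    ∀ᶠ y in nhds x, graphPlus (rot f g y) (trans f g y) = graphPlus (rot f g x) (trans f g x) := by
  have hev : ∀ᶠ y in nhds x, y ∈ Ω ∧ fderiv ℝ (rot f g) y = 0 ∧ fderiv ℝ (trans f g) y = 0 := by
    filter_upwards [h, D.isElliptic_eventually hx he, D.isOpen.mem_nhds hx] with y ⟨v, hv, hy⟩ hel hyΩ
    have h1 := D.fderiv_rot_eq_zero_of_isElliptic hyΩ hel hv
      (D.fderiv_rot_eq_zero_of_fderiv_plus hyΩ hy)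
    refine ⟨hyΩ, h1, ?_⟩
    ext1 w
    rw [D.fderiv_trans hyΩ, h1, zero_apply, zero_cross, neg_zero]
  obtain ⟨r, hr, hball⟩ := Metric.eventually_nhds_iff_ball.1 hev
  filter_upwards [Metric.ball_mem_nhds x hr] with y hy
  have hopen : IsOpen (Metric.ball x r) := Metric.isOpen_ball
  have hpre : IsPreconnected (Metric.ball x r) := (convex_ball x r).isPreconnected
  have hx' : x ∈ Metric.ball x r := Metric.mem_ball_self hr
  have e1 : rot f g y = rot f g x := hopen.is_const_of_fderiv_eq_zero hpre
    (fun z hz => (D.differentiableAt_of D.contDiff_rot (hball z hz).1).differentiableWithinAt)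
    (fun z hz => (hball z hz).2.1) hy hx'
  have e2 : trans f g y = trans f g x := hopen.is_const_of_fderiv_eq_zero hpre
    (fun z hz => (D.differentiableAt_of D.contDiff_trans (hball z hz).1).differentiableWithinAt)
    (fun z hz => (hball z hz).2.2) hy hx'
  rw [e1, e2]

end LocalDeformation

/-! ### Identification of the chosen subspaces -/

theorem epsilon_eq_of_unique {α : Type*} [Nonempty α] {P : α → Prop} {a : α} (ha : P a)
    (h : ∀ b, P b → b = a) : Classical.epsilon P = a :=
  h _ (Classical.epsilon_spec ⟨a, ha⟩)

section Tangent

variable {p : H4 × E3 × E3} (hp : p.1 ≠ 0) {V : Submodule ℝ R44}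
  (hV : ∀ z, z ∈ V ↔ inner ℝ p.1 z.fst = 0 ∧ z.snd = skew p.2 z.fst)
include hV

theorem le_graphPlus : V ≤ (graphPlus p.2.1 p.2.2).1 := fun z hz =>
  mem_graphPlus.2 ((hV z).1 hz).2

theorem le_twisted : V ≤ (twisted p hp).1 := fun z hz =>
  mem_twisted.2 ⟨((hV z).1 hz).1, 0, by rw [((hV z).1 hz).2, zero_smul, add_zero]⟩

theorem eq_or_eq_of_le {W : MaxIsotropic} (hW : V ≤ W.1) :
    W = graphPlus p.2.1 p.2.2 ∨ W = twisted p hp :=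
  eq_graphPlus_or_eq_twisted hp fun _ hu => hW ((hV _).2 ⟨hu, rfl⟩)

/-- Of the two candidates containing `V`, one lies in `Q₊` and the other in the disjoint set `Q₋`,
so the choice is forced. -/
theorem epsilon_Qplus (hp : p.1 ≠ 0) :
    (Classical.epsilon fun W : MaxIsotropic => W ∈ Qplus ∧ V ≤ W.1) =
      graphPlus p.2.1 p.2.2 := by
  refine epsilon_eq_of_unique ⟨graphPlus_mem_Qplus _ _, le_graphPlus hV⟩ ?_
  rintro W ⟨hW, hle⟩
  refine (eq_or_eq_of_le hp hV hle).resolve_right ?_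
  rintro rfl
  exact disjoint_Qplus_Qminus hW (twisted_mem_Qminus p hp)

theorem epsilon_Qminus :
    (Classical.epsilon fun W : MaxIsotropic => W ∈ Qminus ∧ V ≤ W.1) = twisted p hp := by
  refine epsilon_eq_of_unique ⟨twisted_mem_Qminus p hp, le_twisted hp hV⟩ ?_
  rintro W ⟨hW, hle⟩
  refine (eq_or_eq_of_le hp hV hle).resolve_left ?_
  rintro rfl
  exact disjoint_Qplus_Qminus (graphPlus_mem_Qplus _ _) hW

end Tangent

theorem proj_injective : Function.Injective proj := by
  intro W W' h
  apply Subtype.ext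
  ext z
  rw [← Submodule.starProjection_eq_self_iff (K := W.1),
    ← Submodule.starProjection_eq_self_iff (K := W'.1)]
  change proj W z = z ↔ proj W' z = z
  rw [h]

/-! ### Critical sets, charts and the identity principle -/

/-- The Gram determinant of a linear map on the plane. -/
def gram {E : Type*} [NormedAddCommGroup E] [InnerProductSpace ℝ E] (A : E2 →L[ℝ] E) : ℝ :=
  inner ℝ (A (bas 0)) (A (bas 0)) * inner ℝ (A (bas 1)) (A (bas 1)) -
    inner ℝ (A (bas 0)) (A (bas 1)) * inner ℝ (A (bas 0)) (A (bas 1))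

/-- The equality case of Cauchy–Schwarz: `|a|² b - (a · b) a` has squared norm `|a|²` times the Gram
determinant. Rank less than 2 thus becomes the vanishing of one analytic function. -/
theorem gram_eq_zero_iff {E : Type*} [NormedAddCommGroup E] [InnerProductSpace ℝ E]
    (A : E2 →L[ℝ] E) : gram A = 0 ↔ ¬ Function.Injective A := by
  constructor
  · intro h hA
    set a := A (bas 0) with ha
    set b := A (bas 1) with hb
    have h0 : (inner ℝ a a : ℝ) • b - (inner ℝ a b : ℝ) • a = 0 := by
      rw [← inner_self_eq_zero (𝕜 := ℝ)]
      simp only [inner_sub_left, inner_sub_right, inner_smul_left, inner_smul_right, conj_trivial,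
        real_inner_comm a b]
      rw [gram] at h
      linear_combination (inner ℝ a a : ℝ) * h
    rw [ha, hb, ← map_smul, ← map_smul, ← map_sub] at h0
    have h1 := hA (h0.trans (map_zero A).symm)
    have h2 := congrArg (fun v : E2 => v 1) h1
    have h3 : (inner ℝ a a : ℝ) = 0 := by
      rw [ha]
      simpa [bas] using h2
    have h4 : bas 0 = 0 := hA ((inner_self_eq_zero.1 h3).trans (map_zero A).symm)
    have h5 := congrArg (fun v : E2 => v 0) h4
    simp [bas] at h5
  · intro hA
    by_contra hg
    apply hA
    refine (injective_iff_map_eq_zero A).2 fun v hv => ?_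
    rw [eq_bas v, map_add, map_smul, map_smul] at hv
    have h0 := congrArg (fun u => (inner ℝ (A (bas 0)) u : ℝ)) hv
    have h1 := congrArg (fun u => (inner ℝ (A (bas 1)) u : ℝ)) hv
    simp only [inner_add_right, inner_smul_right, inner_zero_right] at h0 h1
    rw [real_inner_comm (A (bas 0))] at h1
    have e0 : v 0 * gram A = 0 := by
      rw [gram]
      linear_combination (inner ℝ (A (bas 1)) (A (bas 1)) : ℝ) * h0 -
        (inner ℝ (A (bas 0)) (A (bas 1)) : ℝ) * h1
    have e1 : v 1 * gram A = 0 := by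
      rw [gram]
      linear_combination (inner ℝ (A (bas 0)) (A (bas 0)) : ℝ) * h1 -
        (inner ℝ (A (bas 0)) (A (bas 1)) : ℝ) * h0
    rw [eq_bas v, (mul_eq_zero.1 e0).resolve_right hg, (mul_eq_zero.1 e1).resolve_right hg]
    simp

theorem contDiff_gram {E : Type*} [NormedAddCommGroup E] [InnerProductSpace ℝ E]
    {n : WithTop ℕ∞} : ContDiff ℝ n (gram : (E2 →L[ℝ] E) → ℝ) := by
  have h : ∀ i, ContDiff ℝ n (fun A : E2 →L[ℝ] E => A (bas i)) := fun i =>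
    contDiff_id.clm_apply contDiff_const
  exact (((h 0).inner ℝ (h 0)).mul ((h 1).inner ℝ (h 1))).sub
    (((h 0).inner ℝ (h 1)).mul ((h 0).inner ℝ (h 1)))

section Manifold

variable {S : Type*} [TopologicalSpace S] [ChartedSpace E2 S]
  {E : Type*} [NormedAddCommGroup E] [NormedSpace ℝ E]

/-- The representative of a map in the preferred chart at a point. -/
def inChart (F : S → E) (p₀ : S) : E2 → E := F ∘ (chartAt E2 p₀).symm

omit [NormedAddCommGroup E] [NormedSpace ℝ E] in
theorem inChart_apply (F : S → E) {p₀ p : S} (hp : p ∈ (chartAt E2 p₀).source) :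
    inChart F p₀ (chartAt E2 p₀ p) = F p := by
  rw [inChart, Function.comp_apply, (chartAt E2 p₀).left_inv hp]

/-- The identity principle: a set that is locally the zero set of analytic functions is closed, and
its interior is open and closed. -/
theorem isClosed_and_isClopen_interior {Z : Set S}
    (h : ∀ p₀ : S, ∃ D : E2 → E, AnalyticOnNhd ℝ D (chartAt E2 p₀).target ∧
      ∀ p ∈ (chartAt E2 p₀).source, p ∈ Z ↔ D (chartAt E2 p₀ p) = 0) :
    IsClosed Z ∧ IsClopen (interior Z) := by
  constructor
  · rw [← isOpen_compl_iff, isOpen_iff_mem_nhds]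
    intro p₀ hp₀
    obtain ⟨D, hD, hZ⟩ := h p₀
    have hs := mem_chart_source E2 p₀
    have hc : ContinuousAt (fun p => D (chartAt E2 p₀ p)) p₀ :=
      ContinuousAt.comp (g := D) (hD _ (mem_chart_target E2 p₀)).continuousAt
        ((chartAt E2 p₀).continuousAt hs)
    have hne : D (chartAt E2 p₀ p₀) ≠ 0 := fun h0 => hp₀ ((hZ p₀ hs).2 h0)
    filter_upwards [hc.eventually_ne hne, (chartAt E2 p₀).open_source.mem_nhds hs] with p h1 h2 h3
    exact h1 ((hZ p h2).1 h3)
  · refine ⟨?_, isOpen_interior⟩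
    rw [← closure_subset_iff_isClosed]
    intro p₀ hp₀
    obtain ⟨D, hD, hZ⟩ := h p₀
    set c := chartAt E2 p₀ with hc
    have hs : p₀ ∈ c.source := mem_chart_source E2 p₀
    -- `D` vanishes near some point of this connected ball, hence on all of it, including around the
    -- image of `p₀`.
    obtain ⟨r, hr, hball⟩ := Metric.isOpen_iff.1 c.open_target (c p₀) (mem_chart_target E2 p₀)
    have hN : c.source ∩ c ⁻¹' Metric.ball (c p₀) r ∈ nhds p₀ :=
      Filter.inter_mem (c.open_source.mem_nhds hs)
        ((c.continuousAt hs).preimage_mem_nhds (Metric.ball_mem_nhds _ hr))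
    obtain ⟨p, ⟨hp1, hp2⟩, hpZ⟩ := mem_closure_iff_nhds.1 hp₀ _ hN
    have hev : D =ᶠ[nhds (c p)] 0 := by
      have ht : c p ∈ c.target := c.map_source hp1
      have hcs : Filter.Tendsto c.symm (nhds (c p)) (nhds p) := by
        have := c.continuousAt_symm ht
        rwa [ContinuousAt, c.left_inv hp1] at this
      filter_upwards [hcs.eventually (mem_interior_iff_mem_nhds.1 hpZ),
        c.open_target.mem_nhds ht] with y hy hyt
      have := (hZ _ (c.map_target hyt)).1 hy
      rwa [c.right_inv hyt] at this
    have hzero := (hD.mono hball).eqOn_zero_of_preconnected_of_eventuallyEq_zero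
      (convex_ball _ _).isPreconnected hp2 hev
    rw [mem_interior_iff_mem_nhds]
    filter_upwards [hN] with q ⟨hq1, hq2⟩
    exact (hZ q hq1).2 (hzero hq2)

variable [IsManifold 𝓘(ℝ, E2) ω S]

theorem contDiffOn_inChart {F : S → E} (hF : ContMDiff 𝓘(ℝ, E2) 𝓘(ℝ, E) ω F) (p₀ : S) :
    ContDiffOn ℝ ω (inChart F p₀) (chartAt E2 p₀).target := by
  rw [← contMDiffOn_iff_contDiffOn]
  exact hF.comp_contMDiffOn
    (contMDiffOn_chart_symm (I := 𝓘(ℝ, E2)) (n := ω) (x := p₀))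

theorem contMDiffAt_of_inChart {F : S → E} {p₀ : S} {G : E2 → E}
    (hG : ContDiffOn ℝ ω G (chartAt E2 p₀).target)
    (h : ∀ p ∈ (chartAt E2 p₀).source, F p = G (chartAt E2 p₀ p)) :
    ContMDiffAt 𝓘(ℝ, E2) 𝓘(ℝ, E) ω F p₀ := by
  have hs := (chartAt E2 p₀).open_source.mem_nhds (mem_chart_source E2 p₀)
  have h1 : ContMDiffOn 𝓘(ℝ, E2) 𝓘(ℝ, E) ω (G ∘ chartAt E2 p₀) (chartAt E2 p₀).source :=
    (contMDiffOn_iff_contDiffOn.2 hG).comp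
      (contMDiffOn_chart (I := 𝓘(ℝ, E2)) (n := ω) (x := p₀)) fun _ hp =>
        (chartAt E2 p₀).map_source hp
  refine (h1.contMDiffAt hs).congr_of_eventuallyEq ?_
  filter_upwards [hs] with p hp
  exact h p hp

/-- The differential of the chart at a point of its domain. -/
def chartDiff (p₀ : S) {p : S} (hp : p ∈ (chartAt E2 p₀).source) :
    TangentSpace 𝓘(ℝ, E2) p ≃L[ℝ] E2 :=
  have : IsManifold 𝓘(ℝ, E2) 1 S := IsManifold.of_le (n := ω) le_top
  (mdifferentiable_chart (I := 𝓘(ℝ, E2)) p₀).mfderiv hp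

theorem diffAt_eq {F : S → E} (hF : ContMDiff 𝓘(ℝ, E2) 𝓘(ℝ, E) ω F) (p₀ : S) {p : S}
    (hp : p ∈ (chartAt E2 p₀).source) (v : TangentSpace 𝓘(ℝ, E2) p) :
    diffAt F p v = fderiv ℝ (inChart F p₀) (chartAt E2 p₀ p) (chartDiff p₀ hp v) := by
  have hM : IsManifold 𝓘(ℝ, E2) 1 S := IsManifold.of_le (n := ω) le_top
  set c := chartAt E2 p₀ with hc
  have ht : c p ∈ c.target := c.map_source hp
  have hev : F =ᶠ[nhds p] inChart F p₀ ∘ c := by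
    filter_upwards [c.open_source.mem_nhds hp] with q hq
    exact (inChart_apply F hq).symm
  have hd : DifferentiableAt ℝ (inChart F p₀) (c p) :=
    ((contDiffOn_inChart hF p₀).contDiffAt (c.open_target.mem_nhds ht)).differentiableAt (by simp)
  have hcd := (mdifferentiable_chart (I := 𝓘(ℝ, E2)) p₀).mdifferentiableAt hp
  rw [diffAt, hev.mfderiv_eq, mfderiv_comp p hd.mdifferentiableAt hcd, mfderiv_eq_fderiv]
  rfl

theorem injective_diffAt_iff {F : S → E} (hF : ContMDiff 𝓘(ℝ, E2) 𝓘(ℝ, E) ω F) (p₀ : S) {p : S}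
    (hp : p ∈ (chartAt E2 p₀).source) : Function.Injective (diffAt F p) ↔
      Function.Injective (fderiv ℝ (inChart F p₀) (chartAt E2 p₀ p)) := by
  have h : ⇑(diffAt F p) =
      fderiv ℝ (inChart F p₀) (chartAt E2 p₀ p) ∘ chartDiff p₀ hp :=
    funext fun v => diffAt_eq hF p₀ hp v
  rw [h]
  exact (chartDiff p₀ hp).toEquiv.injective_comp _

theorem range_diffAt {F : S → E} (hF : ContMDiff 𝓘(ℝ, E2) 𝓘(ℝ, E) ω F) (p₀ : S) {p : S}
    (hp : p ∈ (chartAt E2 p₀).source) : LinearMap.range (diffAt F p).toLinearMap =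
      LinearMap.range (fderiv ℝ (inChart F p₀) (chartAt E2 p₀ p)).toLinearMap := by
  ext z
  constructor
  · rintro ⟨v, rfl⟩
    exact ⟨chartDiff p₀ hp v, (diffAt_eq hF p₀ hp v).symm⟩
  · rintro ⟨w, rfl⟩
    refine ⟨(chartDiff p₀ hp).symm w, (diffAt_eq hF p₀ hp _).trans ?_⟩
    rw [ContinuousLinearEquiv.apply_symm_apply]
    rfl

/-- The critical set of an analytic map is closed, and its interior is open and closed. -/
theorem critical_isClosed_and_isClopen [FiniteDimensional ℝ E] {F : S → E}
    (hF : ContMDiff 𝓘(ℝ, E2) 𝓘(ℝ, E) ω F) :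
    IsClosed {p | ¬ Function.Injective (diffAt F p)} ∧
      IsClopen (interior {p | ¬ Function.Injective (diffAt F p)}) := by
  apply isClosed_and_isClopen_interior (E := ℝ)
  intro p₀
  -- The Gram determinant needs an inner product, which `E` (for instance a space of operators) may
  -- lack; a linear isomorphism does not affect injectivity.
  let e : (E ≃L[ℝ] _) := toEuclidean (E := E)
  have hopen := (chartAt E2 p₀).open_target
  have h1 : ContDiffOn ℝ ω (fun y => gram (e.toContinuousLinearMap ∘L fderiv ℝ (inChart F p₀) y))
      (chartAt E2 p₀).target :=
    contDiff_gram.comp_contDiffOn (contDiffOn_const.clm_comp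
      ((contDiffOn_inChart hF p₀).fderiv_of_isOpen hopen le_top))
  refine ⟨_, fun y hy => (h1.contDiffAt (hopen.mem_nhds hy)).analyticAt, fun p hp => ?_⟩
  rw [gram_eq_zero_iff, Set.mem_ofPred_eq, injective_diffAt_iff hF p₀ hp, not_iff_not]
  exact (e.toEquiv.comp_injective _).symm

theorem isClopen_interior_fiber {F : S → E} (hF : ContMDiff 𝓘(ℝ, E2) 𝓘(ℝ, E) ω F) (a : E) :
    IsClopen (interior {p | F p = a}) := by
  refine (isClosed_and_isClopen_interior (E := E) fun p₀ => ?_).2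
  have hopen := (chartAt E2 p₀).open_target
  have h1 : ContDiffOn ℝ ω (fun y => inChart F p₀ y - a) (chartAt E2 p₀).target :=
    (contDiffOn_inChart hF p₀).sub contDiffOn_const
  refine ⟨_, fun y hy => (h1.contDiffAt (hopen.mem_nhds hy)).analyticAt, fun p hp => ?_⟩
  rw [inChart_apply F hp, sub_eq_zero]
  rfl

end Manifold

/-! ### The global argument on a compact surface -/

section Surface

variable {S : Type*} [TopologicalSpace S] [ChartedSpace E2 S] [IsManifold 𝓘(ℝ, E2) ω S]

theorem hasRankTwoOnDenseOpen_of_interior_eq_empty {Φ : S → MaxIsotropic}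
    (hΦ : ContMDiff 𝓘(ℝ, E2) 𝓘(ℝ, R44 →L[ℝ] R44) ω fun p => proj (Φ p))
    (h : interior {p | ¬ Function.Injective (diffAt (fun p => proj (Φ p)) p)} = ∅) :
    HasRankTwoOnDenseOpen Φ := by
  refine ⟨_, (critical_isClosed_and_isClopen hΦ).1.isOpen_compl,
    interior_eq_empty_iff_dense_compl.1 h, hΦ.contMDiffOn, fun p hp => ?_⟩
  have hinj : Function.Injective (diffAt (fun p => proj (Φ p)) p) := not_not.1 hp
  rw [LinearMap.finrank_range_of_inj hinj]
  exact finrank_euclideanSpace_fin (𝕜 := ℝ) (n := 2)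

/-- An infinitesimal isometric deformation of an immersed surface. -/
structure SurfaceDeformation (f g : S → E3) : Prop where
  contMDiff_f : ContMDiff 𝓘(ℝ, E2) 𝓘(ℝ, E3) ω f
  contMDiff_g : ContMDiff 𝓘(ℝ, E2) 𝓘(ℝ, E3) ω g
  isImmersed : IsImmersed f
  isometric : IsInfIsometricDeformation f g

namespace SurfaceDeformation

variable {f g : S → E3} (hD : SurfaceDeformation f g)
include hD

theorem localDeformation (p₀ : S) :
    LocalDeformation (chartAt E2 p₀).target (inChart f p₀) (inChart g p₀) where
  isOpen := (chartAt E2 p₀).open_target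
  contDiff_f := contDiffOn_inChart hD.contMDiff_f p₀
  contDiff_g := contDiffOn_inChart hD.contMDiff_g p₀
  injective x hx := by
    have hp := (chartAt E2 p₀).map_target hx
    have h := (injective_diffAt_iff hD.contMDiff_f p₀ hp).1 (hD.isImmersed _)
    rwa [(chartAt E2 p₀).right_inv hx] at h
  isometric x hx v := by
    have hp := (chartAt E2 p₀).map_target hx
    have h := hD.isometric _ ((chartDiff p₀ hp).symm v)
    rwa [diffAt_eq hD.contMDiff_f p₀ hp, diffAt_eq hD.contMDiff_g p₀ hp,
      ContinuousLinearEquiv.apply_symm_apply, (chartAt E2 p₀).right_inv hx] at h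

theorem contMDiff_psi : ContMDiff 𝓘(ℝ, E2) 𝓘(ℝ, R44) ω (psi f g) := by
  intro p₀
  have D := hD.localDeformation p₀
  refine contMDiffAt_of_inChart (G := lift (inChart f p₀) (inChart g p₀)) ?_ fun p hp => ?_
  · exact pairL.contDiff.comp_contDiffOn
      ((ptL.contDiff.comp_contDiffOn (D.contDiff_f.prodMk (contDiffOn_const (c := (1 : ℝ))))).prodMk
        (ptL.contDiff.comp_contDiffOn (D.contDiff_g.prodMk (D.contDiff_f.inner ℝ D.contDiff_g).neg)))
  · rw [lift, inChart_apply f hp, inChart_apply g hp]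
    rfl

theorem mem_tangentPlane {p₀ p : S} (hp : p ∈ (chartAt E2 p₀).source) (z : R44) :
    z ∈ tangentPlane f g p ↔
      inner ℝ (minusPoint (inChart f p₀) (inChart g p₀) (chartAt E2 p₀ p)).1 z.fst = 0 ∧
      z.snd = skew (minusPoint (inChart f p₀) (inChart g p₀) (chartAt E2 p₀ p)).2 z.fst := by
  have D := hD.localDeformation p₀
  have h1 : psi f g p = lift (inChart f p₀) (inChart g p₀) (chartAt E2 p₀ p) := by
    rw [lift, inChart_apply f hp, inChart_apply g hp]
    rfl
  rw [tangentPlane, range_diffAt hD.contMDiff_psi p₀ hp, h1]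
  exact D.mem_tangent ((chartAt E2 p₀).map_source hp) z

theorem phiPlus_eq {p₀ p : S} (hp : p ∈ (chartAt E2 p₀).source) : phiPlus f g p =
    graphPlus (rot (inChart f p₀) (inChart g p₀) (chartAt E2 p₀ p))
      (trans (inChart f p₀) (inChart g p₀) (chartAt E2 p₀ p)) :=
  epsilon_Qplus (p := minusPoint (inChart f p₀) (inChart g p₀) (chartAt E2 p₀ p)) (hD.mem_tangentPlane hp)
    ((hD.localDeformation p₀).minusPoint_ne_zero ((chartAt E2 p₀).map_source hp))

theorem phiMinus_eq {p₀ p : S} (hp : p ∈ (chartAt E2 p₀).source) : phiMinus f g p =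
    twisted (minusPoint (inChart f p₀) (inChart g p₀) (chartAt E2 p₀ p))
      ((hD.localDeformation p₀).minusPoint_ne_zero ((chartAt E2 p₀).map_source hp)) :=
  epsilon_Qminus _ (hD.mem_tangentPlane hp)

theorem contMDiff_phiPlus :
    ContMDiff 𝓘(ℝ, E2) 𝓘(ℝ, R44 →L[ℝ] R44) ω fun p => proj (phiPlus f g p) := fun p₀ =>
  contMDiffAt_of_inChart (hD.localDeformation p₀).contDiff_plus fun p hp => by
    rw [hD.phiPlus_eq hp]

theorem contMDiff_phiMinus :
    ContMDiff 𝓘(ℝ, E2) 𝓘(ℝ, R44 →L[ℝ] R44) ω fun p => proj (phiMinus f g p) := fun p₀ =>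
  contMDiffAt_of_inChart (hD.localDeformation p₀).contDiff_minus fun p hp => by
    rw [hD.phiMinus_eq hp]
    rfl

theorem inChart_phiPlus {p₀ : S} {x : E2} (hx : x ∈ (chartAt E2 p₀).target) :
    inChart (fun p => proj (phiPlus f g p)) p₀ =ᶠ[nhds x] fun y =>
      proj (graphPlus (rot (inChart f p₀) (inChart g p₀) y)
        (trans (inChart f p₀) (inChart g p₀) y)) := by
  filter_upwards [(chartAt E2 p₀).open_target.mem_nhds hx] with y hy
  change proj (phiPlus f g ((chartAt E2 p₀).symm y)) = _
  rw [hD.phiPlus_eq ((chartAt E2 p₀).map_target hy), (chartAt E2 p₀).right_inv hy]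

theorem inChart_phiMinus {p₀ : S} {x : E2} (hx : x ∈ (chartAt E2 p₀).target) :
    inChart (fun p => proj (phiMinus f g p)) p₀ =ᶠ[nhds x] fun y =>
      (LinearMap.range (minusParam
        (minusPoint (inChart f p₀) (inChart g p₀) y)).toLinearMap).starProjection := by
  filter_upwards [(chartAt E2 p₀).open_target.mem_nhds hx] with y hy
  change proj (phiMinus f g ((chartAt E2 p₀).symm y)) = _
  rw [hD.phiMinus_eq ((chartAt E2 p₀).map_target hy)]
  change (LinearMap.range (minusParam _).toLinearMap).starProjection = _
  rw [(chartAt E2 p₀).right_inv hy]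

/-- Every nonempty open and closed part of a compact surface has an elliptic point. -/
theorem exists_isElliptic [CompactSpace S] {C : Set S} (hC : IsClopen C) (hne : C.Nonempty) :
    ∃ p ∈ C, IsElliptic (inChart f p) (chartAt E2 p p) := by
  have hcont : Continuous fun p => (inner ℝ (f p) (f p) : ℝ) :=
    hD.contMDiff_f.continuous.inner hD.contMDiff_f.continuous
  -- The point of `C` farthest from the origin; as `C` is open, the maximum is local on the whole
  -- surface.
  obtain ⟨p, hp, hmax⟩ := hC.1.isCompact.exists_isMaxOn hne hcont.continuousOn
  refine ⟨p, hp, ?_⟩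
  have hs := mem_chart_source E2 p
  have ht := mem_chart_target E2 p
  apply (hD.localDeformation p).isElliptic_of_isLocalMax ht
  have hcs : Filter.Tendsto (chartAt E2 p).symm (nhds (chartAt E2 p p)) (nhds p) := by
    have := (chartAt E2 p).continuousAt_symm ht
    rwa [ContinuousAt, (chartAt E2 p).left_inv hs] at this
  have hev : ∀ᶠ q in nhds p, (inner ℝ (f q) (f q) : ℝ) ≤ inner ℝ (f p) (f p) := by
    filter_upwards [hC.2.mem_nhds hp] with q hq
    exact hmax hq
  filter_upwards [hcs.eventually hev] with y hy
  rw [inChart_apply f hs]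
  exact hy

/-- The interior of the critical set is open and closed; were it nonempty, it would contain an
elliptic point, where `φ₋` is immersive. Connectedness plays no role. -/
theorem hasRankTwo_phiMinus [CompactSpace S] : HasRankTwoOnDenseOpen (phiMinus f g) := by
  have hF := hD.contMDiff_phiMinus
  apply hasRankTwoOnDenseOpen_of_interior_eq_empty hF
  by_contra hne
  obtain ⟨p, hp, hell⟩ := hD.exists_isElliptic (critical_isClosed_and_isClopen hF).2
    (Set.nonempty_iff_ne_empty.2 hne)
  have hs := mem_chart_source E2 p
  have ht := mem_chart_target E2 p
  refine interior_subset hp ((injective_diffAt_iff hF p hs).2 ?_)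
  rw [(hD.inChart_phiMinus ht).fderiv_eq]
  exact (injective_iff_map_eq_zero _).2 fun v hv =>
    (hD.localDeformation p).eq_zero_of_fderiv_minus ht hell hv

/-- If the critical set had interior, it would be the whole connected surface; around an elliptic
point `φ₊` would then be locally constant, and the identity principle would make it constant. -/
theorem hasRankTwo_phiPlus [CompactSpace S] [ConnectedSpace S]
    (hconst : ¬ ∃ W : MaxIsotropic, ∀ p : S, phiPlus f g p = W) :
    HasRankTwoOnDenseOpen (phiPlus f g) := by
  have hF := hD.contMDiff_phiPlus
  apply hasRankTwoOnDenseOpen_of_interior_eq_empty hF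
  by_contra hne
  have huniv := (critical_isClosed_and_isClopen hF).2.eq_univ (Set.nonempty_iff_ne_empty.2 hne)
  obtain ⟨p, -, hell⟩ := hD.exists_isElliptic (C := Set.univ) isClopen_univ Set.univ_nonempty
  have hs := mem_chart_source E2 p
  have ht := mem_chart_target E2 p
  have hcrit : ∀ᶠ y in nhds (chartAt E2 p p), ∃ v ≠ 0, fderiv ℝ (fun y =>
      proj (graphPlus (rot (inChart f p) (inChart g p) y)
        (trans (inChart f p) (inChart g p) y))) y v = 0 := by
    filter_upwards [(chartAt E2 p).open_target.mem_nhds ht] with y hy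
    have hq := (chartAt E2 p).map_target hy
    have hmem : (chartAt E2 p).symm y ∈
        interior {p | ¬ Function.Injective (diffAt (fun p => proj (phiPlus f g p)) p)} :=
      huniv ▸ Set.mem_univ _
    have h1 := interior_subset hmem
    rw [Set.mem_ofPred_eq, injective_diffAt_iff hF p hq, (chartAt E2 p).right_inv hy,
      (hD.inChart_phiPlus hy).fderiv_eq, injective_iff_map_eq_zero] at h1
    push Not at h1
    obtain ⟨v, h1, h2⟩ := h1
    exact ⟨v, h2, h1⟩
  have hev := (hD.localDeformation p).plus_eventually_const ht hell hcrit
  have hfib : p ∈ interior {q | proj (phiPlus f g q) = proj (phiPlus f g p)} := by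
    rw [mem_interior_iff_mem_nhds]
    filter_upwards [((chartAt E2 p).continuousAt hs).eventually hev,
      (chartAt E2 p).open_source.mem_nhds hs] with q h1 h2
    rw [hD.phiPlus_eq h2, hD.phiPlus_eq hs, h1]
  have huniv' := (isClopen_interior_fiber hF (proj (phiPlus f g p))).eq_univ ⟨p, hfib⟩
  refine hconst ⟨phiPlus f g p, fun q => proj_injective ?_⟩
  have hq : q ∈ interior {q | proj (phiPlus f g q) = proj (phiPlus f g p)} :=
    huniv' ▸ Set.mem_univ _
  have hq' : q ∈ {q | proj (phiPlus f g q) = proj (phiPlus f g p)} := interior_subset hq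
  exact hq'

end SurfaceDeformation

end Surface

end Darboux

end

theorem proposition13 {S : Type*} [TopologicalSpace S] [T2Space S] [CompactSpace S]
    [ChartedSpace Darboux.E2 S] [IsManifold 𝓘(ℝ, Darboux.E2) ω S]
    (f g : S → Darboux.E3)
    (hf : ContMDiff 𝓘(ℝ, Darboux.E2) 𝓘(ℝ, Darboux.E3) ω f)
    (hg : ContMDiff 𝓘(ℝ, Darboux.E2) 𝓘(ℝ, Darboux.E3) ω g)
    (hf_imm : Darboux.IsImmersed f)
    (hfg : Darboux.IsInfIsometricDeformation f g) :
    Darboux.HasRankTwoOnDenseOpen (Darboux.phiMinus f g) ∧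
    (ConnectedSpace S →
      (¬ ∃ W : Darboux.MaxIsotropic, ∀ p : S, Darboux.phiPlus f g p = W) →
        Darboux.HasRankTwoOnDenseOpen (Darboux.phiPlus f g)) := by
  have hD : Darboux.SurfaceDeformation f g := ⟨hf, hg, hf_imm, hfg⟩
  exact ⟨hD.hasRankTwo_phiMinus, fun _ hconst => hD.hasRankTwo_phiPlus hconst⟩
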